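/- **Convergence of Parallel Rank-1 Deflation.** Let $Y = W^\star X$ with $W^\star\in\mathbb{R}^{m\times d}$, $X\in\mathbb{R}^{d\times n}$, let $\sigma_1^\star\ge\sigma_2^\star\ge\cdots$ be the singular values of $Y$ (extended by zeros), and let $\|\cdot\|$ be the Frobenius norm. Let $r\ge 0$, let $\texttt{Rank1}$ be a subroutine that returns a pair of vectors, let $T$ be its number of local iterations and $Q$ a projection radius. Consider the following algorithm. Start from vectors $a_{k,0}\in\mathbb{R}^d$, $b_{k,0}\in\mathbb{R}^m$ ($1\le k\le r$), with $\|b_{1,0}a_{1,0}^\top X\|\le Q$. In round $\ell\ge 1$ every worker $k>\ell$ keeps $(a_{k,\ell},b_{k,\ell})=(a_{k,\ell-1},b_{k,\ell-1})$, while every worker $k\le\ell$ forms $Y_{k,\ell}=Y-\sum_{k'<k}b_{k',\ell-1}a_{k',\ell-1}^\top X$, computes $(\tilde a_{k,\ell},\tilde b_{k,\ell})=\texttt{Rank1}(Y_{k,\ell},X,T,a_{k,\ell-1},b_{k,\ell-1})$, and takes $(a_{k,\ell},b_{k,\ell})$ such that $b_{k,\ell}a_{k,\ell}^\top X$ is the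 projection of $\tilde b_{k,\ell}\tilde a_{k,\ell}^\top X$ onto the Frobenius ball of radius $Q$ centred at $0$. Let $(\bar a_{k,\ell},\bar b_{k,\ell})$ be a minimizer of $\|Y_{k,\ell}-ba^\top X\|$ over $a\in\mathbb{R}^d$, $b\in\mathbb{R}^m$ (for $\ell\ge k$), and let $(a_k^\star,b_k^\star)$ be, recursively in $k$, a minimizer of $\|Y-\sum_{k'<k}b_{k'}^\star a_{k'}^{\star\top}X-ba^\top X\|$. Put $G_{k,\ell}=\|b_{k,\ell}a_{k,\ell}^\top X-b_k^\star a_k^{\star\top}X\|$. Assume: 1. (contraction) for every $1\le k\le r$ there is $F_k\in(0,1)$ with $\|\tilde b_{k,\ell}\tilde a_{k,\ell}^\top X-\bar b_{k,\ell}\bar a_{k,\ell}^\top X\|\le F_k\,\|b_{k,\ell-1}a_{k,\ell-1}^\top X-\bar b_{k,\ell}\bar a_{k,\ell}^\top X\|$ for all $\ell\ge k$; 2. (spectral gap) $\sigma_1^\star>\cdots>\sigma_r^\star>0$, and $\mathcal{T}_k=\min\{\min_{j>k}|\sigma_k^\star-\sigma_j^\star|,\ \sigma_k^\star\}>0$ for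 $1\le k\le r$; 3. (projection radius) $Q\ge 2\sigma_1^\star$. Put $R_k=Q+\sigma_k^\star$, $C_k=3\sigma_k^\star/\mathcal{T}_k+1$, $m_1=F_1$ and $m_k=\max\{F_k,\ \tfrac1k+\tfrac{k-1}{k}m_{k-1}\}$ for $2\le k\le r$. For $0<x\le 1/e$ let $\hat W(x)=\max\{1,-W_{-1}(-x)\}$, where $W_{-1}$ is the lower real branch of the Lambert function. Call a sequence of natural numbers $s_1,\dots,s_r$ *admissible* if $s_1=1$ and, for all $1\le k<r$, $$s_{k+1}\ \ge\ \max_{k'\le k}\Bigl\{s_{k'}+\frac{\hat W\bigl(m_{k'}|\log m_{k'}|/k\bigr)}{\log(1/m_{k'})}+\frac{\hat W\bigl(\mathcal{T}_{k+1}m_{k'}|\log m_{k'}|/(6kR_{k'}C_{k+1})\bigr)}{\log(1/m_{k'})}\Bigr\}+\frac{(k+1)m_k}{1-m_k}+2+\frac{\hat W\bigl(m_k|\log m_k|\bigr)}{\log(1/m_k)} .$$ Then: * $0<m_k<1$ for all $1\le k\le r$; * for every admissible sequence, all $1\le k\le r$ and all rounds $\ell\ge s_k-1$, $$G_{k,\ell}\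 \le\ 3R_k\,(\ell-s_k+2)\,m_k^{\,\ell-s_k+1};$$ * there is an admissible sequence such that, for all $1\le k<r$, $$s_{k+1}\ \le\ \max_{k'\le k}\bigl\{s_{k'}+K\,x_{k,k'}\,(1+\log x_{k,k'})\bigr\}+\frac{(k+1)m_k}{1-m_k},\qquad x_{k,k'}=\frac{\log\bigl(k\,C_{k+1}R_{k'}/\mathcal{T}_{k+1}\bigr)}{1-m_k},$$ where $K>0$ is an absolute constant (that is, $s_{k+1}=\max_{k'\le k}\{s_{k'}+\widetilde{O}(x_{k,k'})\}+(k+1)m_k/(1-m_k)$). -/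

import Mathlib

-- `‖M‖` is the Frobenius norm of a matrix `M` throughout.
open scoped Matrix.Norms.Frobenius

noncomputable section

namespace RankOneDeflation

/-! Components `k` and rounds `ℓ` are natural numbers; the components in play are `1 ≤ k ≤ r`. -/

variable {m d n : ℕ}

/-- The fitted rank-one response `b aᵀ X`. -/
def fit (X : Matrix (Fin d) (Fin n) ℝ) (a : Fin d → ℝ) (b : Fin m → ℝ) :
    Matrix (Fin m) (Fin n) ℝ :=
  Matrix.vecMulVec b a * X

/-- `(a, b)` minimizes `‖M - b aᵀ X‖` over all pairs of vectors. -/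
def IsBestFit (X : Matrix (Fin d) (Fin n) ℝ) (M : Matrix (Fin m) (Fin n) ℝ)
    (a : Fin d → ℝ) (b : Fin m → ℝ) : Prop :=
  ∀ (a' : Fin d → ℝ) (b' : Fin m → ℝ), ‖M - fit X a b‖ ≤ ‖M - fit X a' b'‖

/-- Projection onto the closed Frobenius ball of radius `Q` about the origin. -/
def projBall (Q : ℝ) (M : Matrix (Fin m) (Fin n) ℝ) : Matrix (Fin m) (Fin n) ℝ :=
  open Classical in if ‖M‖ ≤ Q then M else (Q / ‖M‖) • M

/-- The deflation target of worker `k` at round `ℓ`: the response minus the previous round's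
estimates of the components before `k`. -/
def target (X : Matrix (Fin d) (Fin n) ℝ) (Y : Matrix (Fin m) (Fin n) ℝ)
    (a : ℕ → ℕ → Fin d → ℝ) (b : ℕ → ℕ → Fin m → ℝ) (k ℓ : ℕ) : Matrix (Fin m) (Fin n) ℝ :=
  Y - ∑ k' ∈ Finset.Ico 1 k, fit X (a k' (ℓ - 1)) (b k' (ℓ - 1))

/-- The clean deflation target of component `k`: the response minus the ideal components
before `k`. -/
def cleanTarget (X : Matrix (Fin d) (Fin n) ℝ) (Y : Matrix (Fin m) (Fin n) ℝ)
    (aStar : ℕ → Fin d → ℝ) (bStar : ℕ → Fin m → ℝ) (k : ℕ) : Matrix (Fin m) (Fin n) ℝ :=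
  Y - ∑ k' ∈ Finset.Ico 1 k, fit X (aStar k') (bStar k')

/-- A rank-one subroutine: it receives a target, the inputs `X`, a number of local iterations and
a warm start, and returns a pair `(a, b)`. -/
abbrev Subroutine (m d n : ℕ) : Type :=
  Matrix (Fin m) (Fin n) ℝ → Matrix (Fin d) (Fin n) ℝ → ℕ → (Fin d → ℝ) → (Fin m → ℝ) →
    (Fin d → ℝ) × (Fin m → ℝ)

/-- The output of the subroutine for worker `k` at round `ℓ`, warm-started at the previous round's
estimate, before the projection. -/
def rawOutput (rank1 : Subroutine m d n) (X : Matrix (Fin d) (Fin n) ℝ)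
    (Y : Matrix (Fin m) (Fin n) ℝ) (T : ℕ)
    (a : ℕ → ℕ → Fin d → ℝ) (b : ℕ → ℕ → Fin m → ℝ) (k ℓ : ℕ) : (Fin d → ℝ) × (Fin m → ℝ) :=
  rank1 (target X Y a b k ℓ) X T (a k (ℓ - 1)) (b k (ℓ - 1))

/-- `(a, b)` is a run of parallel rank-one deflation with `r` workers, started at arbitrary
`(a k 0, b k 0)`: worker `k` is idle before round `k`; from round `k` on it calls the subroutine
on its current target and replaces the output by factors of the projection of the fitted response
onto the Frobenius ball of radius `Q`. -/
structure IsRun (rank1 : Subroutine m d n) (X : Matrix (Fin d) (Fin n) ℝ)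
    (Y : Matrix (Fin m) (Fin n) ℝ) (r T : ℕ) (Q : ℝ)
    (a : ℕ → ℕ → Fin d → ℝ) (b : ℕ → ℕ → Fin m → ℝ) : Prop where
  idle : ∀ k ∈ Finset.Icc 1 r, ∀ ℓ : ℕ, 1 ≤ ℓ → ℓ < k →
    a k ℓ = a k (ℓ - 1) ∧ b k ℓ = b k (ℓ - 1)
  active : ∀ k ∈ Finset.Icc 1 r, ∀ ℓ : ℕ, k ≤ ℓ →
    fit X (a k ℓ) (b k ℓ) =
      projBall Q
        (fit X (rawOutput rank1 X Y T a b k ℓ).1 (rawOutput rank1 X Y T a b k ℓ).2)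

/-- The subroutine contracts along the run towards the ideal rank-one fits `(aBar, bBar)`, with
factor `F k` for component `k`. -/
def Contracts (rank1 : Subroutine m d n) (X : Matrix (Fin d) (Fin n) ℝ)
    (Y : Matrix (Fin m) (Fin n) ℝ) (r T : ℕ)
    (a : ℕ → ℕ → Fin d → ℝ) (b : ℕ → ℕ → Fin m → ℝ)
    (aBar : ℕ → ℕ → Fin d → ℝ) (bBar : ℕ → ℕ → Fin m → ℝ) (F : ℕ → ℝ) : Prop :=
  ∀ k ∈ Finset.Icc 1 r, (0 < F k ∧ F k < 1) ∧ ∀ ℓ : ℕ, k ≤ ℓ →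
    ‖fit X (rawOutput rank1 X Y T a b k ℓ).1 (rawOutput rank1 X Y T a b k ℓ).2
        - fit X (aBar k ℓ) (bBar k ℓ)‖
      ≤ F k * ‖fit X (a k (ℓ - 1)) (b k (ℓ - 1)) - fit X (aBar k ℓ) (bBar k ℓ)‖

/-- The `k`-th largest singular value, counted from `k = 1` and with multiplicity
(`0` beyond the rank). -/
def sigma (Y : Matrix (Fin m) (Fin n) ℝ) (k : ℕ) : ℝ :=
  (Matrix.toEuclideanLin Y).singularValues (k - 1)

/-- The gap `min {min_{j > k} |σ_k - σ_j|, σ_k}`. -/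
def gap (Y : Matrix (Fin m) (Fin n) ℝ) (k : ℕ) : ℝ :=
  min (⨅ j : Set.Ioi k, |sigma Y k - sigma Y j|) (sigma Y k)

/-- The leading `r` singular values are positive and distinct, with positive gaps. -/
structure SpectralGap (Y : Matrix (Fin m) (Fin n) ℝ) (r : ℕ) : Prop where
  strict : ∀ k : ℕ, 1 ≤ k → k < r → sigma Y (k + 1) < sigma Y k
  pos : ∀ k ∈ Finset.Icc 1 r, 0 < sigma Y k
  gap_pos : ∀ k ∈ Finset.Icc 1 r, 0 < gap Y k

/-- The total error `‖b_{k,ℓ} a_{k,ℓ}ᵀ X - b⋆_k a⋆_kᵀ X‖`. -/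
def totalError (X : Matrix (Fin d) (Fin n) ℝ)
    (a : ℕ → ℕ → Fin d → ℝ) (b : ℕ → ℕ → Fin m → ℝ)
    (aStar : ℕ → Fin d → ℝ) (bStar : ℕ → Fin m → ℝ) (k ℓ : ℕ) : ℝ :=
  ‖fit X (a k ℓ) (b k ℓ) - fit X (aStar k) (bStar k)‖

/-- The magnitude bound `R_k = Q + σ_k`. -/
def magnitude (Y : Matrix (Fin m) (Fin n) ℝ) (Q : ℝ) (k : ℕ) : ℝ := Q + sigma Y k

/-- The perturbation constant `C_k = 3 σ_k / gap_k + 1`. -/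
def pertConst (Y : Matrix (Fin m) (Fin n) ℝ) (k : ℕ) : ℝ := 3 * sigma Y k / gap Y k + 1

/-- The effective rates `m_1 = F_1`, `m_k = max {F_k, 1/k + ((k-1)/k) m_{k-1}}` for `k ≥ 2`.
(The value at `0` is not used.) -/
def rate (F : ℕ → ℝ) : ℕ → ℝ
  | 0 => 0
  | 1 => F 1
  | k + 2 => max (F (k + 2))
      (1 / ((k : ℝ) + 2) + ((k : ℝ) + 1) / ((k : ℝ) + 2) * rate F (k + 1))

/-- The branch `W_{-1}` of the Lambert function on `[-1/e, 0)`: the unique `w ≤ -1` with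
`w e^w = x`. -/
def lambertWm1 (x : ℝ) : ℝ := sInf {w : ℝ | w ≤ -1 ∧ w * Real.exp w = x}

/-- `Ŵ(x) = max {1, -W_{-1}(-x)}`, for `0 < x ≤ 1/e`. -/
def lambertHat (x : ℝ) : ℝ := max 1 (-lambertWm1 (-x))

/-- The Lambert-`W` lower bound on `s_{k+1}` in terms of `s_1, …, s_k` (for `k ≥ 1`). -/
def warmUpBound (Y : Matrix (Fin m) (Fin n) ℝ) (Q : ℝ) (F : ℕ → ℝ) (s : ℕ → ℕ) (k : ℕ) : ℝ :=
  (⨆ k' : Set.Icc 1 k,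
    ((s k' : ℝ)
      + lambertHat (rate F k' * |Real.log (rate F k')| / k) / Real.log (1 / rate F k')
      + lambertHat (gap Y (k + 1) * (rate F k' * |Real.log (rate F k')|)
            / (6 * k * magnitude Y Q k' * pertConst Y (k + 1)))
          / Real.log (1 / rate F k')))
  + (((k : ℝ) + 1) * rate F k / (1 - rate F k) + 2
      + lambertHat (rate F k * |Real.log (rate F k)|) / Real.log (1 / rate F k))

/-- `s` is an admissible sequence of warm-up rounds: `s_1 = 1`, and every `s_{k+1}` is at least
the Lambert-`W` bound. -/
def IsWarmUp (Y : Matrix (Fin m) (Fin n) ℝ) (Q : ℝ) (F : ℕ → ℝ) (r : ℕ) (s : ℕ → ℕ) : Prop :=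
  s 1 = 1 ∧ ∀ k : ℕ, 1 ≤ k → k < r → warmUpBound Y Q F s k ≤ (s (k + 1) : ℝ)

/-- `log (k C_{k+1} R_{k'} / gap_{k+1}) / (1 - m_k)`. -/
def logCost (Y : Matrix (Fin m) (Fin n) ℝ) (Q : ℝ) (F : ℕ → ℝ) (k k' : ℕ) : ℝ :=
  Real.log (k * pertConst Y (k + 1) * magnitude Y Q k' / gap Y (k + 1)) / (1 - rate F k)

/-- `max_{k' ≤ k} {s_{k'} + K x (1 + log x)} + (k+1) m_k / (1 - m_k)`, where
`x = log (k C_{k+1} R_{k'} / gap_{k+1}) / (1 - m_k)` (for `k ≥ 1`). -/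
def simplifiedBound (Y : Matrix (Fin m) (Fin n) ℝ) (Q : ℝ) (F : ℕ → ℝ) (K : ℝ) (s : ℕ → ℕ)
    (k : ℕ) : ℝ :=
  (⨆ k' : Set.Icc 1 k,
    ((s k' : ℝ) + K * (logCost Y Q F k k' * (1 + Real.log (logCost Y Q F k k')))))
  + ((k : ℝ) + 1) * rate F k / (1 - rate F k)

end RankOneDeflation

end

/-!
Convergence of parallel rank-one deflation.

The ideal components are the leading singular components `σ_k u_k v_kᵀ` of `Y`; since `Y = W X`,
the vectors `v_k` lie in the row space of `X`, so these matrices are of the form `b aᵀ X`. The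
central fact is a stability bound for best approximations in a cone (`norm_best_sub_le`): if the
correlation of a target `A` with the elements of the cone drops linearly away from its best
approximation `σ N`, then a best approximation `P` of any `M` satisfies
`‖P - σ N‖ ≤ (2 σ / g + 1) ‖M - A‖`. The linear drop for the deflated response is
`deflated_form_le`, where the rate `g` is the spectral gap. With `M = A` the bound identifies the
ideal components (`fit_star_eq`); with `M` the actual target it gives, together with the
contraction hypothesis and the nonexpansiveness of the projection, the recurrence
`G_{k,ℓ} ≤ F_k G_{k,ℓ-1} + 2 C_k ∑_{j<k} G_{j,ℓ-1}` (`totalError_le`).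

Convergence follows by induction on `k`. The error of component `j` at a delay `t` after `s_j` is
of the form `t μ ^ (t - 1)` with `μ = rate F j`. The Lambert terms in the definition of an
admissible sequence are delays after which such a quantity is as small as the forcing may be, and
the averaging in the definition of the rates makes `rate F (k + 1)` large enough, compared to
`rate F j`, to absorb the linear factor `t` (`mul_pow_le_of_delay`). A sequence with forcing
`O(M ^ q)` and contraction factor at most `M` is then `O((q + 1) M ^ q)`
(`le_mul_pow_of_forced`).

The least admissible sequence rounds each lower bound up to an integer. Its size follows from
`Ŵ(y) ≤ 2 log (1 / y)` (`lambertHat_le`), applied to each Lambert term (`lambertHat_div_log_le`).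
-/

namespace RankOneDeflation

/-! ### Best approximation in a cone of an inner product space -/

section Cone

variable {E : Type*} [NormedAddCommGroup E] [InnerProductSpace ℝ E]

open scoped RealInnerProductSpace

/-- A best approximation `P` of `M` in a cone is the projection of `M` onto the line through `P`. -/
theorem inner_eq_norm_sq_of_best {C : Set E} (hC : ∀ (t : ℝ), ∀ Z ∈ C, t • Z ∈ C) {M P : E}
    (hP : P ∈ C) (hbest : ∀ Z ∈ C, ‖M - P‖ ≤ ‖M - Z‖) : ⟪M, P⟫ = ‖P‖ ^ 2 := by
  have key : ∀ s : ℝ, 0 ≤ ‖P‖ ^ 2 * (s * s) + (-(2 * ⟪M - P, P⟫)) * s + 0 := by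
    intro s
    have h := pow_le_pow_left₀ (norm_nonneg _) (hbest _ (hC (1 + s) P hP)) 2
    have e : M - (1 + s) • P = (M - P) - s • P := by module
    rw [e, norm_sub_sq_real (M - P) (s • P), inner_smul_right, norm_smul, mul_pow,
      Real.norm_eq_abs, sq_abs] at h
    nlinarith
  have h0 := discrim_le_zero key
  have h1 : ⟪M - P, P⟫ = 0 := by
    unfold discrim at h0
    nlinarith [sq_nonneg ⟪M - P, P⟫]
  rw [inner_sub_left, real_inner_self_eq_norm_sq] at h1
  linarith

/-- The norm of the best approximation is the largest correlation of `M` with a unit element of the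
cone. -/
theorem inner_le_of_best {C : Set E} (hC : ∀ (t : ℝ), ∀ Z ∈ C, t • Z ∈ C) {M P : E}
    (hP : P ∈ C) (hbest : ∀ Z ∈ C, ‖M - P‖ ≤ ‖M - Z‖) {Z : E} (hZ : Z ∈ C) :
    ⟪M, Z⟫ ≤ ‖P‖ * ‖Z‖ := by
  have hPP := inner_eq_norm_sq_of_best hC hP hbest
  have key : ∀ t : ℝ, 0 ≤ ‖Z‖ ^ 2 * (t * t) + (-(2 * ⟪M, Z⟫)) * t + ‖P‖ ^ 2 := by
    intro t
    have h := pow_le_pow_left₀ (norm_nonneg _) (hbest _ (hC t Z hZ)) 2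
    rw [norm_sub_sq_real, norm_sub_sq_real, hPP, inner_smul_right, norm_smul, mul_pow,
      Real.norm_eq_abs, sq_abs] at h
    nlinarith
  have h0 := discrim_le_zero key
  unfold discrim at h0
  refine abs_le_of_sq_le_sq' ?_ (by positivity) |>.2
  nlinarith

/-- Stability of the best approximation in a cone `C`. If the target `A` has the best
approximation `σ • N`, and its correlation with the elements of `C` drops away from `N` at rate
`g`, then every best approximation of `M` in `C` lies within `(2 σ / g + 1) ‖M - A‖` of `σ • N`.
No smallness of `M - A` is needed: comparing the values of `M` at the two maximizers bounds the
angle between them. -/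
theorem norm_best_sub_le {C : Set E} (hC : ∀ (t : ℝ), ∀ Z ∈ C, t • Z ∈ C) {A M P N : E}
    (hP : P ∈ C) (hbest : ∀ Z ∈ C, ‖M - P‖ ≤ ‖M - Z‖) {σ g : ℝ} (hN : N ∈ C) (hN1 : ‖N‖ = 1)
    (hg : 0 < g) (hgσ : g ≤ σ) (hAN : ⟪A, N⟫ = σ)
    (hA : ∀ Z ∈ C, ⟪A, Z⟫ ≤ (σ - g) * ‖Z‖ + g * ⟪N, Z⟫) :
    ‖P - σ • N‖ ≤ (2 * σ / g + 1) * ‖M - A‖ := by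
  set e := ‖M - A‖ with he
  have he0 : 0 ≤ e := norm_nonneg _
  have hσ : 0 < σ := hg.trans_le hgσ
  have hNv : σ - e ≤ ‖P‖ := by
    have h1 := inner_le_of_best hC hP hbest hN
    have h2 := abs_le.1 (abs_real_inner_le_norm (M - A) N)
    rw [inner_sub_left, hAN, hN1] at h2
    rw [hN1] at h1
    linarith [h2.1]
  by_cases hP0 : P = 0
  · have : 0 ≤ 2 * σ / g := by positivity
    rw [hP0, zero_sub, norm_neg, norm_smul, hN1, Real.norm_eq_abs, abs_of_pos hσ]
    rw [hP0, norm_zero] at hNv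
    nlinarith
  have hp : 0 < ‖P‖ := norm_pos_iff.2 hP0
  set p := ‖P‖ with hpdef
  set Z : E := p⁻¹ • P with hZdef
  have hZC : Z ∈ C := hC _ _ hP
  have hZ1 : ‖Z‖ = 1 := by
    rw [hZdef, norm_smul, Real.norm_eq_abs, abs_of_pos (inv_pos.2 hp), ← hpdef,
      inv_mul_cancel₀ hp.ne']
  have hPZ : P = p • Z := by rw [hZdef, smul_inv_smul₀ hp.ne']
  have hMZ : ⟪M, Z⟫ = p := by
    rw [hZdef, inner_smul_right, inner_eq_norm_sq_of_best hC hP hbest, ← hpdef]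
    field_simp
  have hMN : ⟪M, N⟫ ≤ p := by simpa [hN1] using inner_le_of_best hC hP hbest hN
  have hAZ := hA Z hZC
  rw [hZ1, mul_one] at hAZ
  have hc1 : ⟪N, Z⟫ ≤ 1 := by
    simpa [hN1, hZ1] using real_inner_le_norm N Z
  set δ := ‖Z - N‖ with hδ
  have hδ0 : 0 ≤ δ := norm_nonneg _
  have hδsq : δ ^ 2 = 2 - 2 * ⟪N, Z⟫ := by
    rw [hδ, norm_sub_sq_real, hZ1, hN1, real_inner_comm]
    ring
  have hcs : ⟪M - A, Z - N⟫ ≤ e * δ := real_inner_le_norm _ _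
  rw [inner_sub_left, inner_sub_right, inner_sub_right, hAN, hMZ] at hcs
  -- The linear drop gives `g * δ ^ 2 / 2 ≤ ⟪M - A, Z - N⟫`, where `δ ^ 2 = 2 - 2 * ⟪N, Z⟫`.
  have hδe : g * δ ≤ 2 * e := by
    by_contra! hcon
    have : 0 < δ := by
      rcases hδ0.eq_or_lt with h | h
      · rw [← h] at hcon; linarith
      · exact h
    nlinarith
  have hpσ : |p - σ| ≤ e := by
    have h2 := abs_le.1 (abs_real_inner_le_norm (M - A) Z)
    rw [inner_sub_left, hMZ, hZ1] at h2
    rw [abs_le]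
    constructor
    · linarith
    · nlinarith [h2.2]
  have hdec : P - σ • N = (p - σ) • Z + σ • (Z - N) := by
    rw [hPZ]; module
  calc ‖P - σ • N‖ ≤ |p - σ| * 1 + σ * δ := by
        rw [hdec]
        refine (norm_add_le _ _).trans ?_
        rw [norm_smul (p - σ), norm_smul σ, hZ1, Real.norm_eq_abs, Real.norm_eq_abs,
          abs_of_pos hσ]
    _ ≤ e + σ * (2 * e / g) := by
        have : δ ≤ 2 * e / g := by rw [le_div_iff₀ hg]; linarith
        rw [mul_one]; gcongr
    _ = (2 * σ / g + 1) * e := by ring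

end Cone

/-! ### The Frobenius inner product and the projection onto a ball -/

/-- The inner product `∑ i j, A i j * B i j` on matrices, inducing the Frobenius norm. -/
noncomputable instance frobeniusInnerProductSpace {m n : ℕ} :
    InnerProductSpace ℝ (Matrix (Fin m) (Fin n) ℝ) where
  toNormedSpace := Matrix.frobeniusNormedSpace
  inner A B := ∑ i, ∑ j, A i j * B i j
  norm_sq_eq_re_inner A := by
    rw [Matrix.frobenius_norm_def, ← Real.sqrt_eq_rpow, Real.sq_sqrt (by positivity)]
    simp [sq]
  conj_inner_symm A B := by simp [mul_comm]
  add_left A B C := by simp [add_mul, Finset.sum_add_distrib]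
  smul_left A B t := by simp [Finset.mul_sum, mul_assoc]

section Frobenius

variable {m d n : ℕ}

open scoped RealInnerProductSpace

theorem frobenius_inner_def (A B : Matrix (Fin m) (Fin n) ℝ) :
    ⟪A, B⟫ = ∑ i, ∑ j, A i j * B i j := rfl

theorem norm_projBall_le {Q : ℝ} (hQ : 0 ≤ Q) (M : Matrix (Fin m) (Fin n) ℝ) :
    ‖projBall Q M‖ ≤ Q := by
  unfold projBall
  split_ifs with h
  · exact h
  · push Not at h
    rw [norm_smul, Real.norm_eq_abs, abs_of_nonneg (by positivity),
      div_mul_cancel₀ _ (hQ.trans_lt h).ne']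

/-- The projection onto the ball does not increase the distance to a point of the ball. -/
theorem norm_projBall_sub_le {Q : ℝ} {M S : Matrix (Fin m) (Fin n) ℝ} (hS : ‖S‖ ≤ Q) :
    ‖projBall Q M - S‖ ≤ ‖M - S‖ := by
  unfold projBall
  split_ifs with h
  · exact le_rfl
  · push Not at h
    have hQ : 0 ≤ Q := (norm_nonneg S).trans hS
    have hM : 0 < ‖M‖ := hQ.trans_lt h
    set c := Q / ‖M‖ with hc
    have hcM : c * ‖M‖ = Q := div_mul_cancel₀ _ hM.ne'
    have hc0 : 0 ≤ c := by positivity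
    have hc1 : c < 1 := by rwa [hc, div_lt_one hM]
    have hcs : ⟪M, S⟫ ≤ ‖M‖ * Q :=
      (real_inner_le_norm M S).trans (by gcongr)
    refine abs_le_of_sq_le_sq' ?_ (norm_nonneg _) |>.2
    rw [norm_sub_sq_real, norm_sub_sq_real, inner_smul_left, norm_smul, Real.norm_eq_abs,
      abs_of_nonneg hc0, hcM, conj_trivial]
    have : 0 ≤ (1 - c) * (‖M‖ * Q - ⟪M, S⟫) := mul_nonneg (by linarith) (by linarith)
    nlinarith [sq_nonneg (‖M‖ - Q)]

end Frobenius

/-! ### Singular vectors and the deflated bilinear form -/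

section SingularVectors

open scoped RealInnerProductSpace
open Module

variable {E F : Type*} [NormedAddCommGroup E] [InnerProductSpace ℝ E] [FiniteDimensional ℝ E]
  [NormedAddCommGroup F] [InnerProductSpace ℝ F] [FiniteDimensional ℝ F]

/-- The `i`-th right singular vector of `L` (from `i = 0`), an eigenvector of the adjoint of `L`
composed with `L`; zero from the dimension of the domain on. -/
noncomputable def rightVec (L : E →ₗ[ℝ] F) (i : ℕ) : E :=
  if h : i < finrank ℝ E then L.isSymmetric_adjoint_comp_self.eigenvectorBasis rfl ⟨i, h⟩ else 0

/-- The `i`-th left singular vector of `L` (from `i = 0`); zero if the singular value vanishes. -/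
noncomputable def leftVec (L : E →ₗ[ℝ] F) (i : ℕ) : F :=
  (L.singularValues i)⁻¹ • L (rightVec L i)

theorem lt_finrank_of_singularValues_pos {L : E →ₗ[ℝ] F} {i : ℕ} (h : 0 < L.singularValues i) :
    i < finrank ℝ E := by
  by_contra! hi
  rw [L.singularValues_of_finrank_le hi] at h
  exact h.false

theorem rightVec_eq {L : E →ₗ[ℝ] F} {i : ℕ} (h : i < finrank ℝ E) :
    rightVec L i = L.isSymmetric_adjoint_comp_self.eigenvectorBasis rfl ⟨i, h⟩ := by
  rw [rightVec, dif_pos h]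

theorem norm_rightVec {L : E →ₗ[ℝ] F} {i : ℕ} (h : 0 < L.singularValues i) :
    ‖rightVec L i‖ = 1 := by
  rw [rightVec_eq (lt_finrank_of_singularValues_pos h)]
  exact OrthonormalBasis.norm_eq_one _ _

theorem inner_rightVec (L : E →ₗ[ℝ] F) {i j : ℕ} (hij : i ≠ j) :
    ⟪rightVec L i, rightVec L j⟫ = 0 := by
  by_cases hi : i < finrank ℝ E
  · by_cases hj : j < finrank ℝ E
    · rw [rightVec_eq hi, rightVec_eq hj]
      exact (OrthonormalBasis.orthonormal _).2 (by simpa using hij)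
    · simp [rightVec, hj]
  · simp [rightVec, hi]

theorem apply_rightVec {L : E →ₗ[ℝ] F} {i : ℕ} (h : 0 < L.singularValues i) :
    L (rightVec L i) = L.singularValues i • leftVec L i := by
  rw [leftVec, smul_inv_smul₀ h.ne']

theorem adjoint_apply_rightVec (L : E →ₗ[ℝ] F) (i : ℕ) :
    L.adjoint (L (rightVec L i)) = L.singularValues i ^ 2 • rightVec L i := by
  by_cases hi : i < finrank ℝ E
  · rw [rightVec_eq hi, L.sq_singularValues_of_lt rfl hi]
    exact L.isSymmetric_adjoint_comp_self.apply_eigenvectorBasis rfl ⟨i, hi⟩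
  · simp [rightVec, hi]

theorem adjoint_leftVec {L : E →ₗ[ℝ] F} {i : ℕ} (h : 0 < L.singularValues i) :
    L.adjoint (leftVec L i) = L.singularValues i • rightVec L i := by
  rw [leftVec, map_smul, adjoint_apply_rightVec, smul_smul]
  congr 1
  field_simp

theorem inner_apply_rightVec (L : E →ₗ[ℝ] F) (i : ℕ) (z : E) :
    ⟪L (rightVec L i), L z⟫ = L.singularValues i ^ 2 * ⟪rightVec L i, z⟫ := by
  rw [← LinearMap.adjoint_inner_left, adjoint_apply_rightVec, inner_smul_left, conj_trivial]

theorem norm_leftVec {L : E →ₗ[ℝ] F} {i : ℕ} (h : 0 < L.singularValues i) :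
    ‖leftVec L i‖ = 1 := by
  have h1 : ‖L (rightVec L i)‖ ^ 2 = L.singularValues i ^ 2 := by
    rw [← real_inner_self_eq_norm_sq, inner_apply_rightVec, real_inner_self_eq_norm_sq,
      norm_rightVec h]
    ring
  have h2 : ‖L (rightVec L i)‖ = L.singularValues i :=
    (pow_left_inj₀ (norm_nonneg _) h.le two_ne_zero).1 h1
  rw [leftVec, norm_smul, h2, Real.norm_eq_abs, abs_of_pos (inv_pos.2 h), inv_mul_cancel₀ h.ne']

theorem inner_leftVec_apply {L : E →ₗ[ℝ] F} {i : ℕ} (h : 0 < L.singularValues i) (z : E) :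
    ⟪leftVec L i, L z⟫ = L.singularValues i * ⟪rightVec L i, z⟫ := by
  rw [← LinearMap.adjoint_inner_left, adjoint_leftVec h, inner_smul_left, conj_trivial]

/-- Off the first `k` right singular vectors, `L` has norm at most `L.singularValues k`. -/
theorem norm_apply_le_of_orthogonal (L : E →ₗ[ℝ] F) (k : ℕ) {z : E}
    (hz : ∀ i < k, ⟪rightVec L i, z⟫ = 0) : ‖L z‖ ≤ L.singularValues k * ‖z‖ := by
  set B := L.isSymmetric_adjoint_comp_self.eigenvectorBasis rfl with hB
  have h1 : ‖L z‖ ^ 2 = ∑ i : Fin (finrank ℝ E), L.singularValues i ^ 2 * ⟪B i, z⟫ ^ 2 := by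
    rw [← real_inner_self_eq_norm_sq, ← LinearMap.adjoint_inner_right, ← B.sum_inner_mul_inner]
    refine Finset.sum_congr rfl fun i _ => ?_
    rw [LinearMap.adjoint_inner_right, ← rightVec_eq i.2, inner_apply_rightVec, real_inner_comm]
    ring
  have h2 : ‖z‖ ^ 2 = ∑ i, ⟪B i, z⟫ ^ 2 := by
    rw [← real_inner_self_eq_norm_sq, ← B.sum_inner_mul_inner]
    refine Finset.sum_congr rfl fun i _ => ?_
    rw [real_inner_comm, sq]
  refine abs_le_of_sq_le_sq' ?_ (mul_nonneg (L.singularValues_nonneg k) (norm_nonneg _)) |>.2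
  rw [mul_pow, h1, h2, Finset.mul_sum]
  refine Finset.sum_le_sum fun i _ => ?_
  rcases lt_or_ge i.1 k with hik | hik
  · have := hz i hik
    rw [rightVec_eq i.2] at this
    rw [this]; simp
  · gcongr
    · exact L.singularValues_nonneg _
    · exact L.singularValues_antitone hik

/-- The bilinear form left after removing the first `k` singular components is at most `σ_k` on
pairs of unit vectors, and drops away from the `k`-th singular pair at the rate of the gap. -/
theorem deflated_form_le {L : E →ₗ[ℝ] F} {k : ℕ} (hpos : ∀ i ≤ k, 0 < L.singularValues i)
    {g : ℝ} (hg : g ≤ L.singularValues k - L.singularValues (k + 1)) (x : F) (y : E) :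
    ⟪x, L y⟫ - ∑ i ∈ Finset.range k,
        L.singularValues i * (⟪leftVec L i, x⟫ * ⟪rightVec L i, y⟫)
      ≤ (L.singularValues k - g) * (‖x‖ * ‖y‖) + g * (⟪leftVec L k, x⟫ * ⟪rightVec L k, y⟫) := by
  set u := leftVec L
  set v := rightVec L
  set σ := L.singularValues
  -- Orthogonal decomposition `y = z + ⟪v k, y⟫ • v k + p` along the first `k + 1` right vectors.
  set p : E := ∑ i ∈ Finset.range k, ⟪v i, y⟫ • v i with hp
  set w : E := y - ⟪v k, y⟫ • v k with hw
  set z : E := w - p with hz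
  have hvp : ∀ j < k, ⟪v j, p⟫ = ⟪v j, y⟫ := by
    intro j hj
    rw [hp, inner_sum, Finset.sum_eq_single j]
    · rw [inner_smul_right, real_inner_self_eq_norm_sq, norm_rightVec (hpos j hj.le)]; ring
    · intro i _ hij
      rw [inner_smul_right, inner_rightVec L hij.symm, mul_zero]
    · intro h; simp at h; omega
  have hvkp : ⟪v k, p⟫ = 0 := by
    rw [hp, inner_sum]
    refine Finset.sum_eq_zero fun i hi => ?_
    rw [inner_smul_right, inner_rightVec L (Finset.mem_range.1 hi).ne', mul_zero]
  have hvkw : ⟪v k, w⟫ = 0 := by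
    rw [hw, inner_sub_right, inner_smul_right, real_inner_self_eq_norm_sq,
      norm_rightVec (hpos k le_rfl)]
    ring
  have hvz : ∀ j < k + 1, ⟪v j, z⟫ = 0 := by
    intro j hj
    rw [hz, inner_sub_right]
    rcases Nat.lt_succ_iff_lt_or_eq.1 hj with h | rfl
    · rw [hvp j h, hw, inner_sub_right, inner_smul_right, inner_rightVec L h.ne]; ring
    · rw [hvkw, hvkp, sub_zero]
  have hpz : ⟪p, z⟫ = 0 := by
    rw [hp, sum_inner]
    refine Finset.sum_eq_zero fun i hi => ?_
    rw [inner_smul_left, hvz i (by have := Finset.mem_range.1 hi; omega), mul_zero]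
  have hzw : ‖z‖ ^ 2 ≤ ‖w‖ ^ 2 := by
    have : w = z + p := by rw [hz]; abel
    rw [this, norm_add_sq_real, real_inner_comm, hpz]
    nlinarith [sq_nonneg ‖p‖]
  set α := ⟪u k, x⟫ with hα
  set β := ⟪v k, y⟫ with hβ
  have hwn : ‖w‖ ^ 2 = ‖y‖ ^ 2 - β ^ 2 := by
    rw [hw, norm_sub_sq_real, inner_smul_right, norm_smul, norm_rightVec (hpos k le_rfl),
      real_inner_comm, ← hβ, mul_one, Real.norm_eq_abs, sq_abs]
    ring
  have hxn : ‖x - α • u k‖ ^ 2 = ‖x‖ ^ 2 - α ^ 2 := by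
    rw [norm_sub_sq_real, inner_smul_right, norm_smul, norm_leftVec (hpos k le_rfl),
      real_inner_comm, ← hα, mul_one, Real.norm_eq_abs, sq_abs]
    ring
  have hLy : L y = L z + σ k • β • u k + ∑ i ∈ Finset.range k, σ i • ⟪v i, y⟫ • u i := by
    have e1 : y = z + β • v k + p := by rw [hz, hw]; abel
    conv_lhs => rw [e1]
    rw [map_add, map_add, map_smul, hp, map_sum, apply_rightVec (hpos k le_rfl), smul_comm]
    congr 1
    refine Finset.sum_congr rfl fun i hi => ?_
    rw [map_smul, apply_rightVec (hpos i (Finset.mem_range.1 hi).le), smul_comm]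
  have hform : ⟪x, L y⟫ - ∑ i ∈ Finset.range k, σ i * (⟪u i, x⟫ * ⟪v i, y⟫)
      = σ k * (α * β) + ⟪x - α • u k, L z⟫ := by
    rw [hLy, inner_add_right, inner_add_right, inner_sum, inner_sub_left, inner_smul_left,
      inner_leftVec_apply (hpos k le_rfl), hvz k (by omega), inner_smul_right, inner_smul_right,
      real_inner_comm (u k) x, ← hα]
    have : ∑ i ∈ Finset.range k, ⟪x, σ i • ⟪v i, y⟫ • u i⟫
        = ∑ i ∈ Finset.range k, σ i * (⟪u i, x⟫ * ⟪v i, y⟫) := by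
      refine Finset.sum_congr rfl fun i _ => ?_
      rw [inner_smul_right, inner_smul_right, real_inner_comm (u i) x]; ring
    rw [this, conj_trivial]; ring
  have hαx : |α| ≤ ‖x‖ := by
    simpa only [u, norm_leftVec (hpos k le_rfl), one_mul] using abs_real_inner_le_norm (u k) x
  have hβy : |β| ≤ ‖y‖ := by
    simpa only [v, norm_rightVec (hpos k le_rfl), one_mul] using abs_real_inner_le_norm (v k) y
  have hαβ : α * β ≤ ‖x‖ * ‖y‖ :=
    (le_abs_self _).trans (by rw [abs_mul]; gcongr)
  have hprod : ‖x - α • u k‖ * ‖z‖ ≤ ‖x‖ * ‖y‖ - α * β := by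
    refine abs_le_of_sq_le_sq' ?_ (by linarith) |>.2
    calc (‖x - α • u k‖ * ‖z‖) ^ 2 ≤ (‖x‖ ^ 2 - α ^ 2) * (‖y‖ ^ 2 - β ^ 2) := by
          rw [mul_pow, hxn]
          have : 0 ≤ ‖x‖ ^ 2 - α ^ 2 := hxn ▸ sq_nonneg _
          exact mul_le_mul_of_nonneg_left (hwn ▸ hzw) this
      _ ≤ (‖x‖ * ‖y‖ - α * β) ^ 2 := by nlinarith [sq_nonneg (‖x‖ * β - ‖y‖ * α)]
  have hrest : ⟪x - α • u k, L z⟫ ≤ σ (k + 1) * (‖x‖ * ‖y‖ - α * β) := by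
    calc ⟪x - α • u k, L z⟫ ≤ ‖x - α • u k‖ * (σ (k + 1) * ‖z‖) :=
          (real_inner_le_norm _ _).trans
            (by gcongr; exact norm_apply_le_of_orthogonal L (k + 1) hvz)
      _ = σ (k + 1) * (‖x - α • u k‖ * ‖z‖) := by ring
      _ ≤ _ := by gcongr; exact L.singularValues_nonneg _
  rw [hform]
  nlinarith [mul_nonneg (sub_nonneg.2 hg) (sub_nonneg.2 hαβ)]

end SingularVectors

/-! ### Ideal components are the singular components -/

section Components

open scoped RealInnerProductSpace
open WithLp (toLp ofLp)

variable {m d n : ℕ}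

theorem inner_vecMulVec_right (A : Matrix (Fin m) (Fin n) ℝ) (b : Fin m → ℝ) (y : Fin n → ℝ) :
    ⟪A, Matrix.vecMulVec b y⟫ = ⟪toLp 2 b, Matrix.toEuclideanLin A (toLp 2 y)⟫ := by
  simp only [frobenius_inner_def, Matrix.vecMulVec_apply, PiLp.inner_apply,
    Matrix.toLpLin_apply, Matrix.mulVec, dotProduct, RCLike.inner_apply, conj_trivial,
    Finset.sum_mul]
  exact Finset.sum_congr rfl fun i _ => Finset.sum_congr rfl fun j _ => by ring

theorem inner_vecMulVec_vecMulVec (b b' : Fin m → ℝ) (y y' : Fin n → ℝ) :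
    ⟪Matrix.vecMulVec b y, Matrix.vecMulVec b' y'⟫
      = ⟪toLp 2 b, toLp 2 b'⟫ * ⟪toLp 2 y, toLp 2 y'⟫ := by
  simp only [frobenius_inner_def, Matrix.vecMulVec_apply, PiLp.inner_apply, RCLike.inner_apply,
    conj_trivial, Finset.sum_mul_sum]
  exact Finset.sum_congr rfl fun i _ => Finset.sum_congr rfl fun j _ => by ring

theorem norm_vecMulVec (b : Fin m → ℝ) (y : Fin n → ℝ) :
    ‖Matrix.vecMulVec b y‖ = ‖toLp 2 b‖ * ‖toLp 2 y‖ := by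
  rw [← pow_left_inj₀ (norm_nonneg _) (by positivity) two_ne_zero, mul_pow,
    ← real_inner_self_eq_norm_sq, inner_vecMulVec_vecMulVec, real_inner_self_eq_norm_sq,
    real_inner_self_eq_norm_sq]

/-- The matrices of the form `b aᵀ X`. -/
def fitCone (m : ℕ) (X : Matrix (Fin d) (Fin n) ℝ) : Set (Matrix (Fin m) (Fin n) ℝ) :=
  {Z | ∃ a b, Z = fit X a b}

theorem fit_eq_vecMulVec (X : Matrix (Fin d) (Fin n) ℝ) (a : Fin d → ℝ) (b : Fin m → ℝ) :
    fit X a b = Matrix.vecMulVec b (Matrix.vecMul a X) := by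
  rw [fit, Matrix.vecMulVec_mul]

theorem smul_mem_fitCone (X : Matrix (Fin d) (Fin n) ℝ) (t : ℝ) :
    ∀ Z ∈ fitCone m X, t • Z ∈ fitCone m X := by
  rintro _ ⟨a, b, rfl⟩
  exact ⟨a, t • b, by rw [fit, fit, Matrix.smul_vecMulVec, Matrix.smul_mul]⟩

/-- The `k`-th singular component `u_k v_kᵀ` of `Y` (from `k = 1`), of Frobenius norm one whenever
`σ_k` is positive. -/
noncomputable def singularPart (Y : Matrix (Fin m) (Fin n) ℝ) (k : ℕ) :
    Matrix (Fin m) (Fin n) ℝ :=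
  Matrix.vecMulVec (ofLp (leftVec (Matrix.toEuclideanLin Y) (k - 1)))
    (ofLp (rightVec (Matrix.toEuclideanLin Y) (k - 1)))

theorem norm_singularPart {Y : Matrix (Fin m) (Fin n) ℝ} {k : ℕ} (h : 0 < sigma Y k) :
    ‖singularPart Y k‖ = 1 := by
  rw [singularPart, norm_vecMulVec]
  simp [norm_leftVec h, norm_rightVec h]

theorem inner_singularPart {Y : Matrix (Fin m) (Fin n) ℝ} {j k : ℕ} (hj : 1 ≤ j) (hjk : j < k) :
    ⟪singularPart Y j, singularPart Y k⟫ = 0 := by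
  rw [singularPart, singularPart, inner_vecMulVec_vecMulVec]
  simp [inner_rightVec (Matrix.toEuclideanLin Y) (show j - 1 ≠ k - 1 by omega)]

theorem inner_self_singularPart {Y : Matrix (Fin m) (Fin n) ℝ} {k : ℕ} (h : 0 < sigma Y k) :
    ⟪Y, singularPart Y k⟫ = sigma Y k := by
  rw [singularPart, inner_vecMulVec_right]
  simp only [WithLp.toLp_ofLp]
  rw [apply_rightVec h, inner_smul_right, real_inner_self_eq_norm_sq, norm_leftVec h]
  simp [sigma]

/-- Since `Y = W X`, the right singular vectors of `Y` lie in the row space of `X`. -/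
theorem singularPart_mem_fitCone {W : Matrix (Fin m) (Fin d) ℝ} {X : Matrix (Fin d) (Fin n) ℝ}
    {Y : Matrix (Fin m) (Fin n) ℝ} (hY : Y = W * X) {k : ℕ} (h : 0 < sigma Y k) :
    singularPart Y k ∈ fitCone m X := by
  set u := leftVec (Matrix.toEuclideanLin Y) (k - 1) with hu
  refine ⟨(sigma Y k)⁻¹ • Matrix.vecMul (ofLp u) W, ofLp u, ?_⟩
  rw [fit_eq_vecMulVec, singularPart, ← hu]
  congr 1
  have h1 : rightVec (Matrix.toEuclideanLin Y) (k - 1)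
      = (sigma Y k)⁻¹ • (Matrix.toEuclideanLin Y).adjoint u := by
    rw [hu, adjoint_leftVec h, sigma]
    exact (inv_smul_smul₀ h.ne' _).symm
  rw [h1, ← Matrix.toEuclideanLin_conjTranspose_eq_adjoint, Matrix.toLpLin_apply,
    Matrix.smul_vecMul, Matrix.vecMul_vecMul, ← hY]
  simp [Matrix.conjTranspose_eq_transpose_of_trivial, Matrix.mulVec_transpose]

theorem sigma_nonneg (Y : Matrix (Fin m) (Fin n) ℝ) (k : ℕ) : 0 ≤ sigma Y k :=
  LinearMap.singularValues_nonneg _ _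

theorem sigma_antitone (Y : Matrix (Fin m) (Fin n) ℝ) : Antitone (sigma Y) := fun _ _ h =>
  LinearMap.singularValues_antitone _ (Nat.sub_le_sub_right h 1)

theorem gap_le_sigma (Y : Matrix (Fin m) (Fin n) ℝ) (k : ℕ) : gap Y k ≤ sigma Y k :=
  min_le_right _ _

theorem gap_le_sub (Y : Matrix (Fin m) (Fin n) ℝ) (k : ℕ) :
    gap Y k ≤ sigma Y k - sigma Y (k + 1) := by
  refine (min_le_left _ _).trans ?_
  have hb : BddBelow (Set.range fun j : Set.Ioi k => |sigma Y k - sigma Y j|) :=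
    ⟨0, by rintro _ ⟨j, rfl⟩; exact abs_nonneg _⟩
  refine (ciInf_le hb ⟨k + 1, Nat.lt_succ_self k⟩).trans ?_
  rw [abs_of_nonneg (sub_nonneg.2 (sigma_antitone Y k.le_succ))]

/-- The response minus its first `k - 1` singular components. -/
noncomputable def deflated (Y : Matrix (Fin m) (Fin n) ℝ) (k : ℕ) : Matrix (Fin m) (Fin n) ℝ :=
  Y - ∑ j ∈ Finset.Ico 1 k, sigma Y j • singularPart Y j

theorem inner_deflated_singularPart {Y : Matrix (Fin m) (Fin n) ℝ} {k : ℕ}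
    (h : 0 < sigma Y k) : ⟪deflated Y k, singularPart Y k⟫ = sigma Y k := by
  rw [deflated, inner_sub_left, inner_self_singularPart h, sum_inner, Finset.sum_eq_zero, sub_zero]
  intro j hj
  rw [Finset.mem_Ico] at hj
  rw [inner_smul_left, inner_singularPart hj.1 hj.2, mul_zero]

theorem inner_deflated_le {X : Matrix (Fin d) (Fin n) ℝ} {Y : Matrix (Fin m) (Fin n) ℝ} {k : ℕ}
    (hk : 1 ≤ k) (h : 0 < sigma Y k) {Z : Matrix (Fin m) (Fin n) ℝ} (hZ : Z ∈ fitCone m X) :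
    ⟪deflated Y k, Z⟫ ≤ (sigma Y k - gap Y k) * ‖Z‖ + gap Y k * ⟪singularPart Y k, Z⟫ := by
  obtain ⟨a, b, rfl⟩ := hZ
  obtain ⟨k, rfl⟩ : ∃ i, k = i + 1 := ⟨k - 1, by omega⟩
  rw [fit_eq_vecMulVec, norm_vecMulVec, singularPart, inner_vecMulVec_vecMulVec]
  set y := Matrix.vecMul a X
  have key := deflated_form_le (L := Matrix.toEuclideanLin Y) (k := k)
    (fun i hi => h.trans_le (LinearMap.singularValues_antitone _ hi)) (gap_le_sub Y (k + 1))
    (toLp 2 b) (toLp 2 y)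
  refine le_trans (le_of_eq ?_) key
  rw [deflated, inner_sub_left, inner_vecMulVec_right, sum_inner, Finset.sum_Ico_eq_sum_range]
  congr 1
  refine Finset.sum_congr rfl fun i _ => ?_
  rw [inner_smul_left, singularPart, inner_vecMulVec_vecMulVec, sigma, Nat.add_sub_cancel_left]
  simp

/-- A best rank-one fit of any target `M` is close to the `k`-th singular component, with a
constant given by the gap. -/
theorem norm_bestFit_sub_le {W : Matrix (Fin m) (Fin d) ℝ} {X : Matrix (Fin d) (Fin n) ℝ}
    {Y : Matrix (Fin m) (Fin n) ℝ} (hY : Y = W * X) {k : ℕ} (hk : 1 ≤ k) (hgap : 0 < gap Y k)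
    {M : Matrix (Fin m) (Fin n) ℝ} {a : Fin d → ℝ} {b : Fin m → ℝ} (hfit : IsBestFit X M a b) :
    ‖fit X a b - sigma Y k • singularPart Y k‖
      ≤ (2 * sigma Y k / gap Y k + 1) * ‖M - deflated Y k‖ := by
  have h : 0 < sigma Y k := hgap.trans_le (gap_le_sigma Y k)
  refine norm_best_sub_le (smul_mem_fitCone X) ⟨a, b, rfl⟩ ?_ (singularPart_mem_fitCone hY h)
    (norm_singularPart h) hgap (gap_le_sigma Y k) (inner_deflated_singularPart h)
    (fun Z hZ => inner_deflated_le hk h hZ)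
  rintro _ ⟨a', b', rfl⟩
  exact hfit a' b'

theorem cleanTarget_eq_deflated {X : Matrix (Fin d) (Fin n) ℝ} {Y : Matrix (Fin m) (Fin n) ℝ}
    {aStar : ℕ → Fin d → ℝ} {bStar : ℕ → Fin m → ℝ} {k : ℕ}
    (h : ∀ j, 1 ≤ j → j < k → fit X (aStar j) (bStar j) = sigma Y j • singularPart Y j) :
    cleanTarget X Y aStar bStar k = deflated Y k := by
  rw [cleanTarget, deflated]
  congr 1
  refine Finset.sum_congr rfl fun j hj => ?_
  rw [Finset.mem_Ico] at hj
  exact h j hj.1 hj.2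

/-- The recursively chosen ideal components are the singular components: with an exact target the
stability bound leaves no freedom. -/
theorem fit_star_eq {W : Matrix (Fin m) (Fin d) ℝ} {X : Matrix (Fin d) (Fin n) ℝ}
    {Y : Matrix (Fin m) (Fin n) ℝ} (hY : Y = W * X) {r : ℕ}
    (hgap : ∀ k ∈ Finset.Icc 1 r, 0 < gap Y k)
    {aStar : ℕ → Fin d → ℝ} {bStar : ℕ → Fin m → ℝ}
    (hstar : ∀ k ∈ Finset.Icc 1 r,
      IsBestFit X (cleanTarget X Y aStar bStar k) (aStar k) (bStar k)) :
    ∀ k ∈ Finset.Icc 1 r, fit X (aStar k) (bStar k) = sigma Y k • singularPart Y k := by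
  intro k
  induction k using Nat.strong_induction_on with
  | _ k ih =>
    intro hk
    have hk' := Finset.mem_Icc.1 hk
    have hT : cleanTarget X Y aStar bStar k = deflated Y k :=
      cleanTarget_eq_deflated fun j hj1 hjk =>
        ih j hjk (Finset.mem_Icc.2 ⟨hj1, hjk.le.trans hk'.2⟩)
    have := norm_bestFit_sub_le hY hk'.1 (hgap k hk) (hstar k hk)
    rw [hT, sub_self, norm_zero, mul_zero] at this
    exact sub_eq_zero.1 (norm_le_zero_iff.1 this)

end Components

/-! ### The recurrence of the total errors -/

section Recurrence

variable {m d n : ℕ}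

theorem norm_target_sub_le {X : Matrix (Fin d) (Fin n) ℝ} {Y : Matrix (Fin m) (Fin n) ℝ}
    (a : ℕ → ℕ → Fin d → ℝ) (b : ℕ → ℕ → Fin m → ℝ)
    (aStar : ℕ → Fin d → ℝ) (bStar : ℕ → Fin m → ℝ) (k ℓ : ℕ) :
    ‖target X Y a b k ℓ - cleanTarget X Y aStar bStar k‖
      ≤ ∑ j ∈ Finset.Ico 1 k, totalError X a b aStar bStar j (ℓ - 1) := by
  have : target X Y a b k ℓ - cleanTarget X Y aStar bStar k
      = -∑ j ∈ Finset.Ico 1 k, (fit X (a j (ℓ - 1)) (b j (ℓ - 1)) - fit X (aStar j) (bStar j)) := by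
    rw [target, cleanTarget, Finset.sum_sub_distrib]; abel
  rw [this, norm_neg]
  exact norm_sum_le _ _

variable {r T : ℕ} {Q : ℝ} {W : Matrix (Fin m) (Fin d) ℝ} {X : Matrix (Fin d) (Fin n) ℝ}
  {Y : Matrix (Fin m) (Fin n) ℝ} {rank1 : Subroutine m d n}
  {a : ℕ → ℕ → Fin d → ℝ} {b : ℕ → ℕ → Fin m → ℝ}
  {aBar : ℕ → ℕ → Fin d → ℝ} {bBar : ℕ → ℕ → Fin m → ℝ}
  {aStar : ℕ → Fin d → ℝ} {bStar : ℕ → Fin m → ℝ} {F : ℕ → ℝ}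

theorem norm_fit_star (hY : Y = W * X) (hgap : ∀ k ∈ Finset.Icc 1 r, 0 < gap Y k)
    (hstar : ∀ k ∈ Finset.Icc 1 r,
      IsBestFit X (cleanTarget X Y aStar bStar k) (aStar k) (bStar k))
    {k : ℕ} (hk : k ∈ Finset.Icc 1 r) : ‖fit X (aStar k) (bStar k)‖ = sigma Y k := by
  have h : 0 < sigma Y k := (hgap k hk).trans_le (gap_le_sigma Y k)
  rw [fit_star_eq hY hgap hstar k hk, norm_smul, norm_singularPart h, Real.norm_eq_abs,
    abs_of_pos h, mul_one]

/-- Once worker `k` is active, its error contracts by `F k` up to the errors of the earlier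
components in the previous round. -/
theorem totalError_le (hY : Y = W * X) (hgap : ∀ k ∈ Finset.Icc 1 r, 0 < gap Y k)
    (hQ : sigma Y 1 ≤ Q) (hrun : IsRun rank1 X Y r T Q a b)
    (hbar : ∀ k ∈ Finset.Icc 1 r, ∀ ℓ : ℕ, k ≤ ℓ →
      IsBestFit X (target X Y a b k ℓ) (aBar k ℓ) (bBar k ℓ))
    (hstar : ∀ k ∈ Finset.Icc 1 r,
      IsBestFit X (cleanTarget X Y aStar bStar k) (aStar k) (bStar k))
    (hF : Contracts rank1 X Y r T a b aBar bBar F)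
    {k : ℕ} (hk : k ∈ Finset.Icc 1 r) {ℓ : ℕ} (hℓ : k ≤ ℓ) :
    totalError X a b aStar bStar k ℓ ≤ F k * totalError X a b aStar bStar k (ℓ - 1)
      + 2 * pertConst Y k * ∑ j ∈ Finset.Ico 1 k, totalError X a b aStar bStar j (ℓ - 1) := by
  have hk1 := (Finset.mem_Icc.1 hk).1
  have hg := hgap k hk
  have hσ : 0 < sigma Y k := hg.trans_le (gap_le_sigma Y k)
  obtain ⟨⟨hF0, hF1⟩, hcon⟩ := hF k hk
  have hS := fit_star_eq hY hgap hstar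
  have hclean : cleanTarget X Y aStar bStar k = deflated Y k :=
    cleanTarget_eq_deflated fun j hj1 hjk =>
      hS j (Finset.mem_Icc.2 ⟨hj1, hjk.le.trans (Finset.mem_Icc.1 hk).2⟩)
  set D := ∑ j ∈ Finset.Ico 1 k, totalError X a b aStar bStar j (ℓ - 1) with hD
  have hbs : ‖fit X (aBar k ℓ) (bBar k ℓ) - fit X (aStar k) (bStar k)‖ ≤ pertConst Y k * D := by
    have h1 := norm_bestFit_sub_le hY hk1 hg (hbar k hk ℓ hℓ)
    rw [← hS k hk, ← hclean] at h1
    refine h1.trans ?_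
    have h3 : 2 * sigma Y k / gap Y k + 1 ≤ pertConst Y k := by
      rw [pertConst]; gcongr; norm_num
    have h4 : 0 ≤ 2 * sigma Y k / gap Y k + 1 := by positivity
    exact mul_le_mul h3 (norm_target_sub_le a b aStar bStar k ℓ) (norm_nonneg _) (h4.trans h3)
  set B := fit X (aBar k ℓ) (bBar k ℓ)
  set S := fit X (aStar k) (bStar k) with hSdef
  set P := fit X (a k (ℓ - 1)) (b k (ℓ - 1)) with hP
  have hball : ‖S‖ ≤ Q := by
    rw [hSdef, norm_fit_star hY hgap hstar hk]
    exact (sigma_antitone Y hk1).trans hQ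
  have hc := hcon ℓ hℓ
  have hPB : ‖P - B‖ ≤ ‖P - S‖ + ‖B - S‖ := by
    rw [norm_sub_rev B S]; exact norm_sub_le_norm_sub_add_norm_sub P S B
  calc totalError X a b aStar bStar k ℓ
      ≤ ‖fit X (rawOutput rank1 X Y T a b k ℓ).1 (rawOutput rank1 X Y T a b k ℓ).2 - S‖ := by
        rw [totalError, hrun.active k hk ℓ hℓ]
        exact norm_projBall_sub_le hball
    _ ≤ F k * ‖P - B‖ + ‖B - S‖ :=
        (norm_sub_le_norm_sub_add_norm_sub _ B _).trans (by gcongr)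
    _ ≤ F k * (‖P - S‖ + ‖B - S‖) + ‖B - S‖ := by gcongr
    _ ≤ F k * ‖P - S‖ + 2 * ‖B - S‖ := by nlinarith [norm_nonneg (B - S)]
    _ ≤ F k * totalError X a b aStar bStar k (ℓ - 1) + 2 * pertConst Y k * D := by
        rw [totalError]
        linarith

theorem totalError_le_magnitude (hY : Y = W * X) (hgap : ∀ k ∈ Finset.Icc 1 r, 0 < gap Y k)
    (hQ : 0 ≤ Q) (hrun : IsRun rank1 X Y r T Q a b)
    (hinit : ‖fit X (a 1 0) (b 1 0)‖ ≤ Q)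
    (hstar : ∀ k ∈ Finset.Icc 1 r,
      IsBestFit X (cleanTarget X Y aStar bStar k) (aStar k) (bStar k))
    {k : ℕ} (hk : k ∈ Finset.Icc 1 r) {ℓ : ℕ} (hℓ : k ≤ ℓ ∨ k = 1 ∧ ℓ = 0) :
    totalError X a b aStar bStar k ℓ ≤ magnitude Y Q k := by
  refine (norm_sub_le _ _).trans ?_
  rw [norm_fit_star hY hgap hstar hk, magnitude]
  gcongr
  rcases hℓ with hℓ | ⟨rfl, rfl⟩
  · rw [hrun.active k hk ℓ hℓ]
    exact norm_projBall_le hQ _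
  · exact hinit

end Recurrence

/-! ### The effective rates -/

section Rates

variable {F : ℕ → ℝ} {r : ℕ}

theorem rate_succ (F : ℕ → ℝ) {k : ℕ} (hk : 1 ≤ k) :
    rate F (k + 1) = max (F (k + 1)) ((1 + k * rate F k) / (k + 1)) := by
  obtain ⟨k, rfl⟩ : ∃ i, k = i + 1 := ⟨k - 1, by omega⟩
  rw [rate]
  congr 1
  push_cast
  field_simp
  ring

theorem rate_mem_Ioo (hF : ∀ k ∈ Finset.Icc 1 r, 0 < F k ∧ F k < 1) :
    ∀ k ∈ Finset.Icc 1 r, 0 < rate F k ∧ rate F k < 1 := by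
  intro k hk
  obtain ⟨hk1, hkr⟩ := Finset.mem_Icc.1 hk
  induction k, hk1 using Nat.le_induction with
  | base => exact hF 1 hk
  | succ k hk1 ih =>
    obtain ⟨h0, h1⟩ := ih (Finset.mem_Icc.2 ⟨hk1, by omega⟩) (by omega)
    obtain ⟨g0, g1⟩ := hF _ hk
    rw [rate_succ F hk1]
    refine ⟨lt_max_of_lt_left g0, max_lt g1 ?_⟩
    have : (0 : ℝ) < k := by exact_mod_cast hk1
    rw [div_lt_one (by positivity)]
    nlinarith

theorem le_rate (F : ℕ → ℝ) {k : ℕ} (hk : 1 ≤ k) : F k ≤ rate F k := by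
  obtain ⟨k, rfl⟩ : ∃ i, k = i + 1 := ⟨k - 1, by omega⟩
  rcases Nat.eq_zero_or_pos k with rfl | h
  · exact le_rfl
  · rw [rate_succ F h]; exact le_max_left _ _

theorem average_le_rate_succ (F : ℕ → ℝ) {k : ℕ} (hk : 1 ≤ k) :
    (1 + k * rate F k) / (k + 1) ≤ rate F (k + 1) := by
  rw [rate_succ F hk]; exact le_max_right _ _

theorem rate_le_rate (hF : ∀ k ∈ Finset.Icc 1 r, 0 < F k ∧ F k < 1) {j k : ℕ} (hj : 1 ≤ j)
    (hjk : j ≤ k) (hkr : k ≤ r) : rate F j ≤ rate F k := by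
  induction k, hjk using Nat.le_induction with
  | base => exact le_rfl
  | succ k hk ih =>
    refine (ih (by omega)).trans (le_trans ?_ (average_le_rate_succ F (hj.trans hk)))
    have := (rate_mem_Ioo hF k (Finset.mem_Icc.2 ⟨hj.trans hk, by omega⟩)).2
    rw [le_div_iff₀ (by positivity)]
    nlinarith

end Rates

/-! ### The Lambert function -/

section Lambert

theorem mul_log_one_div_le_exp {x : ℝ} (hx : 0 < x) : x * Real.log (1 / x) ≤ Real.exp (-1) := by
  set l := Real.log (1 / x) with hl
  have hxl : x = Real.exp (-l) := by
    rw [hl, one_div, Real.log_inv, neg_neg, Real.exp_log hx]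
  have h := Real.add_one_le_exp (l - 1)
  rw [hxl, mul_comm]
  calc l * Real.exp (-l) ≤ Real.exp (l - 1) * Real.exp (-l) := by
        gcongr; linarith
    _ = Real.exp (-1) := by rw [← Real.exp_add]; ring_nf

theorem one_le_log_one_div {y : ℝ} (hy : 0 < y) (hy1 : y ≤ Real.exp (-1)) :
    1 ≤ Real.log (1 / y) := by
  rw [one_div, Real.log_inv, le_neg]
  exact (Real.log_le_iff_le_exp hy).2 hy1

theorem exp_neg_one_le_half : Real.exp (-1) ≤ 1 / 2 := by
  rw [Real.exp_neg, one_div]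
  exact inv_anti₀ two_pos (by linarith [Real.add_one_le_exp 1])

/-- Any solution `w ≥ 1` of `w e^{-w} = y` is at most `2 log (1 / y)`. -/
theorem le_two_mul_log_of_mul_exp {w y : ℝ} (hw : 1 ≤ w) (h : w * Real.exp (-w) = y) :
    w ≤ 2 * Real.log (1 / y) := by
  have hw0 : 0 < w := by linarith
  have h1 : Real.log (1 / y) = w - Real.log w := by
    rw [one_div, Real.log_inv, ← h, Real.log_mul hw0.ne' (Real.exp_pos _).ne', Real.log_exp]
    ring
  have h2 := Real.log_le_sub_one_of_pos (x := w / 2) (by positivity)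
  rw [Real.log_div hw0.ne' two_ne_zero] at h2
  have h3 := Real.log_two_lt_d9
  rw [h1]
  linarith

/-- `lambertWm1` is a root of its defining equation: the set of roots is nonempty by the
intermediate value theorem, closed, and bounded below. -/
theorem lambertWm1_spec {y : ℝ} (hy : 0 < y) (hy1 : y ≤ Real.exp (-1)) :
    lambertWm1 (-y) ≤ -1 ∧ lambertWm1 (-y) * Real.exp (lambertWm1 (-y)) = -y := by
  have hlog := one_le_log_one_div hy hy1
  set l := Real.log (1 / y) with hl
  have hcont : Continuous fun w : ℝ => w * Real.exp w := by fun_prop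
  have hclosed : IsClosed {w : ℝ | w ≤ -1 ∧ w * Real.exp w = -y} :=
    (isClosed_le continuous_id continuous_const).inter (isClosed_eq hcont continuous_const)
  have hbdd : BddBelow {w : ℝ | w ≤ -1 ∧ w * Real.exp w = -y} := by
    refine ⟨-(2 * l), ?_⟩
    rintro w ⟨hw1, hw⟩
    have := le_two_mul_log_of_mul_exp (w := -w) (y := y) (by linarith) (by rw [neg_neg]; linarith)
    linarith
  have hne : {w : ℝ | w ≤ -1 ∧ w * Real.exp w = -y}.Nonempty := by
    have hexp : Real.exp (-(2 * l)) = y ^ 2 := by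
      rw [hl, one_div, Real.log_inv, show -(2 * -Real.log y) = Real.log y + Real.log y by ring,
        Real.exp_add, Real.exp_log hy, sq]
    have hlo : -y ≤ (-(2 * l)) * Real.exp (-(2 * l)) := by
      have h1 : y * l ≤ 1 / 2 := (mul_log_one_div_le_exp hy).trans exp_neg_one_le_half
      rw [hexp]
      nlinarith
    have hhi : (-1) * Real.exp (-1) ≤ -y := by linarith
    obtain ⟨w, ⟨-, hw1⟩, hw⟩ := intermediate_value_Icc' (a := -(2 * l)) (b := -1) (by linarith)
      hcont.continuousOn ⟨hhi, hlo⟩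
    exact ⟨w, hw1, hw⟩
  exact hclosed.csInf_mem hne hbdd

theorem lambertHat_spec {y : ℝ} (hy : 0 < y) (hy1 : y ≤ Real.exp (-1)) :
    1 ≤ lambertHat y ∧ lambertHat y * Real.exp (-lambertHat y) = y := by
  obtain ⟨h1, h2⟩ := lambertWm1_spec hy hy1
  have h : lambertHat y = -lambertWm1 (-y) := max_eq_right (by linarith)
  rw [h, neg_neg]
  exact ⟨by linarith, by linarith⟩

theorem lambertHat_le {y : ℝ} (hy : 0 < y) (hy1 : y ≤ Real.exp (-1)) :
    lambertHat y ≤ 2 * Real.log (1 / y) :=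
  le_two_mul_log_of_mul_exp (lambertHat_spec hy hy1).1 (lambertHat_spec hy hy1).2

end Lambert

/-! ### Decay of the forcing and of the errors -/

section Decay

theorem log_one_div_pos {μ : ℝ} (h0 : 0 < μ) (h1 : μ < 1) : 0 < Real.log (1 / μ) :=
  Real.log_pos (by rwa [one_div, one_lt_inv₀ h0])

theorem mul_log_one_div_le {μ : ℝ} (h0 : 0 < μ) : μ * Real.log (1 / μ) ≤ 1 - μ := by
  have := Real.log_le_sub_one_of_pos (x := 1 / μ) (by positivity)
  calc μ * Real.log (1 / μ) ≤ μ * (1 / μ - 1) := by gcongr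
    _ = 1 - μ := by field_simp

theorem one_sub_le_log_one_div {μ : ℝ} (h0 : 0 < μ) : 1 - μ ≤ Real.log (1 / μ) := by
  have := Real.log_le_sub_one_of_pos h0
  rw [one_div, Real.log_inv]
  linarith

theorem abs_log_eq {μ : ℝ} (h0 : 0 < μ) (h1 : μ < 1) : |Real.log μ| = Real.log (1 / μ) := by
  rw [abs_of_neg (Real.log_neg h0 h1), one_div, Real.log_inv]

/-- The slower rate `M` absorbs a linear factor, by Bernoulli's inequality for `(M / μ) ^ q`. -/
theorem mul_pow_le_of_average_le {μ M : ℝ} (h0 : 0 < μ) (h1 : μ < 1) {k : ℕ}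
    (hM : (1 + k * μ) / (k + 1) ≤ M) (q : ℕ) :
    q * μ ^ q ≤ (k + 1) * μ / (1 - μ) * M ^ q := by
  have hk : (0 : ℝ) < k + 1 := by positivity
  have h1' : 0 < 1 - μ := by linarith
  have hx : (1 - μ) / ((k + 1) * μ) ≤ M / μ - 1 := by
    rw [div_le_iff₀ hk] at hM
    rw [div_sub_one h0.ne', div_le_div_iff₀ (by positivity) h0]
    nlinarith
  have hb := one_add_mul_le_pow (a := (1 - μ) / ((k + 1) * μ))
    (by have : 0 ≤ (1 - μ) / ((k + 1) * μ) := by positivity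
        linarith) q
  have hp : (1 + (1 - μ) / ((k + 1) * μ)) ^ q ≤ (M / μ) ^ q :=
    pow_le_pow_left₀ (by positivity) (by linarith) q
  have h2 : q * ((1 - μ) / ((k + 1) * μ)) ≤ (M / μ) ^ q := by linarith
  rw [div_pow, le_div_iff₀ (by positivity)] at h2
  calc q * μ ^ q = (k + 1) * μ / (1 - μ) * (q * ((1 - μ) / ((k + 1) * μ)) * μ ^ q) := by
        field_simp
    _ ≤ _ := by gcongr

/-- After a delay made of the two Lambert terms and two further rounds, the quantity
`t μ ^ (t - 1)` is at most `3 ε` and decays at the slower rate `M`. The delay `w₂ / log (1 / μ)`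
provides the factor `ε`, and the delay `w₁ / log (1 / μ)` compensates the factor `k + 1` lost in
trading `q μ ^ q` for `M ^ q`. -/
theorem mul_pow_le_of_delay {μ M ε w₁ w₂ : ℝ} (h0 : 0 < μ) (h1 : μ < 1) {k : ℕ} (hk : 1 ≤ k)
    (hM : (1 + k * μ) / (k + 1) ≤ M) (hε : 0 ≤ ε) (hw₁ : 1 ≤ w₁) (hw₂ : 1 ≤ w₂)
    (he₁ : w₁ * Real.exp (-w₁) = μ * Real.log (1 / μ) / k)
    (he₂ : w₂ * Real.exp (-w₂) = ε * (μ * Real.log (1 / μ))) {N q : ℕ}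
    (hN : w₁ / Real.log (1 / μ) + w₂ / Real.log (1 / μ) + 2 + q ≤ N + 1) :
    (N + 1) * μ ^ N ≤ 3 * ε * M ^ q := by
  set l := Real.log (1 / μ) with hl
  have hl0 : 0 < l := log_one_div_pos h0 h1
  have hμl : μ * l ≤ 1 - μ := mul_log_one_div_le h0
  have hk0 : (1 : ℝ) ≤ k := by exact_mod_cast hk
  have hexp : ∀ j : ℕ, μ ^ j = Real.exp (-(l * j)) := by
    intro j
    rw [hl, one_div, Real.log_inv, neg_mul, neg_neg, mul_comm, Real.exp_nat_mul, Real.exp_log h0]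
  have hμM : μ ≤ M := by
    refine le_trans ?_ hM
    rw [le_div_iff₀ (by positivity)]
    nlinarith
  -- `x` is the delay that remains after the second Lambert term.
  set t₂ := w₂ / l with ht₂
  set x : ℝ := N + 1 - q - t₂ with hx
  have ht₂l : t₂ * l = w₂ := div_mul_cancel₀ _ hl0.ne'
  have ht₂0 : 0 < t₂ := by positivity
  have hxl : w₁ + 2 * l ≤ x * l := by
    have : w₁ / l + 2 ≤ x := by linarith
    calc w₁ + 2 * l = (w₁ / l + 2) * l := by rw [add_mul, div_mul_cancel₀ _ hl0.ne']
      _ ≤ x * l := by gcongr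
  have hsplit : μ ^ N * μ = Real.exp (-w₂) * Real.exp (-(x * l)) * μ ^ q := by
    rw [← pow_succ, hexp, hexp, ← Real.exp_add, ← Real.exp_add, ← ht₂l, hx]
    push_cast
    congr 1
    ring
  have hlead : t₂ * Real.exp (-w₂) = ε * μ := by
    apply mul_right_cancel₀ hl0.ne'
    rw [mul_right_comm, ht₂l, he₂]
    ring
  have hexp_t : Real.exp (-w₂) ≤ ε * μ * l := by
    rw [← hlead, mul_right_comm, ht₂l]
    exact le_mul_of_one_le_left (Real.exp_pos _).le hw₂
  have hxexp : x * l * Real.exp (-(x * l)) ≤ 1 := by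
    calc x * l * Real.exp (-(x * l)) ≤ Real.exp (x * l) * Real.exp (-(x * l)) := by
          gcongr; linarith [Real.add_one_le_exp (x * l)]
      _ = 1 := by rw [← Real.exp_add]; simp
  have hx0 : 0 < x * l := by nlinarith
  have hexp1 : Real.exp (-(x * l)) ≤ 1 := Real.exp_le_one_iff.2 (by linarith)
  have hexp2 : Real.exp (-(x * l)) ≤ μ * l / k * μ ^ 2 := by
    calc Real.exp (-(x * l)) ≤ Real.exp (-w₁) * Real.exp (-(l * (2 : ℕ))) := by
          rw [← Real.exp_add, Real.exp_le_exp]; push_cast; linarith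
      _ ≤ μ * l / k * μ ^ 2 := by
          rw [hexp 2]
          gcongr
          rw [← he₁]
          exact le_mul_of_one_le_left (Real.exp_pos _).le hw₁
  have hpow : μ ^ q ≤ M ^ q := pow_le_pow_left₀ h0.le hμM q
  have hq : q * l * Real.exp (-(x * l)) * μ ^ q ≤ M ^ q := by
    have hb := mul_pow_le_of_average_le h0 h1 hM q
    have h1' : 0 < 1 - μ := by linarith
    have hMq : 0 ≤ M ^ q := pow_nonneg (h0.le.trans hμM) q
    calc q * l * Real.exp (-(x * l)) * μ ^ q
        = l * Real.exp (-(x * l)) * (q * μ ^ q) := by ring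
      _ ≤ l * (μ * l / k * μ ^ 2) * ((k + 1) * μ / (1 - μ) * M ^ q) := by gcongr
      _ = (μ * l) ^ 2 * (μ ^ 2 * ((k + 1) / k) / (1 - μ)) * M ^ q := by field_simp
      _ ≤ (1 - μ) ^ 2 * (μ ^ 2 * 2 / (1 - μ)) * M ^ q := by
          gcongr
          rw [div_le_iff₀ (by linarith)]
          linarith
      _ = 2 * (μ ^ 2 * (1 - μ)) * M ^ q := by field_simp
      _ ≤ 1 * M ^ q := by
          gcongr
          nlinarith [sq_nonneg (2 * μ - 1), mul_pos h0 h1']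
      _ = M ^ q := one_mul _
  have hcore : ((N + 1 : ℝ) * μ ^ N) * μ ≤ (3 * ε * M ^ q) * μ := by
    have e1 : (N + 1 : ℝ) = t₂ + x + q := by rw [hx]; ring
    have hMq : 0 ≤ M ^ q := pow_nonneg (h0.le.trans hμM) q
    have hεμ : 0 ≤ ε * μ := by positivity
    calc ((N + 1 : ℝ) * μ ^ N) * μ
        = t₂ * Real.exp (-w₂) * (Real.exp (-(x * l)) * μ ^ q)
          + (x * Real.exp (-(x * l)) * μ ^ q + q * Real.exp (-(x * l)) * μ ^ q)
            * Real.exp (-w₂) := by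
          rw [mul_assoc, hsplit, e1]; ring
      _ ≤ ε * μ * (1 * M ^ q)
          + (x * Real.exp (-(x * l)) * μ ^ q + q * Real.exp (-(x * l)) * μ ^ q)
            * (ε * μ * l) := by
          have : 0 < x := pos_of_mul_pos_left hx0 hl0.le
          rw [hlead]
          gcongr
      _ = ε * μ * (M ^ q + (x * l * Real.exp (-(x * l)) * μ ^ q
            + q * l * Real.exp (-(x * l)) * μ ^ q)) := by ring
      _ ≤ ε * μ * (M ^ q + (1 * M ^ q + M ^ q)) := by gcongr
      _ = (3 * ε * M ^ q) * μ := by ring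
  exact le_of_mul_le_mul_right hcore h0

/-- A sequence contracted at rate `f ≤ M` with a forcing of size `3 R M ^ (q + 1)` is
`O((q + 1) M ^ q)`. -/
theorem le_mul_pow_of_forced {G : ℕ → ℝ} {f M R : ℝ} {p : ℕ} (hf : f ≤ M) (hM : 0 ≤ M)
    (hG : ∀ q, 0 ≤ G q) (hR : 0 ≤ R) (hinit : G p ≤ R)
    (hstep : ∀ q, G (p + q + 1) ≤ f * G (p + q) + 3 * R * M ^ (q + 1)) (q : ℕ) :
    G (p + q) ≤ 3 * R * (q + 1) * M ^ q := by
  induction q with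
  | zero => simp; linarith
  | succ q ih =>
    calc G (p + q + 1) ≤ f * G (p + q) + 3 * R * M ^ (q + 1) := hstep q
      _ ≤ M * (3 * R * (q + 1) * M ^ q) + 3 * R * M ^ (q + 1) := by
          gcongr
          exact hG _
      _ = _ := by push_cast; ring

end Decay

/-! ### Consequences of admissibility -/

section WarmUp

variable {m n r : ℕ} {Q : ℝ} {Y : Matrix (Fin m) (Fin n) ℝ} {F : ℕ → ℝ}

theorem four_le_pertConst {k : ℕ} (hgap : 0 < gap Y k) : 4 ≤ pertConst Y k := by
  have : 3 ≤ 3 * sigma Y k / gap Y k := by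
    rw [le_div_iff₀ hgap]; linarith [gap_le_sigma Y k]
  rw [pertConst]; linarith

theorem three_mul_gap_le_magnitude (hQ : 2 * sigma Y 1 ≤ Q) {j k : ℕ} (hj : 1 ≤ j) (hjk : j ≤ k) :
    3 * gap Y k ≤ magnitude Y Q j := by
  have h1 := sigma_antitone Y (hj.trans hjk)
  have h2 := sigma_antitone Y hjk
  have h3 := gap_le_sigma Y k
  rw [magnitude]; linarith

/-- The factor by which the second Lambert term of `warmUpBound` reduces the forcing from
component `j` on component `k + 1`. -/
noncomputable def damping (Y : Matrix (Fin m) (Fin n) ℝ) (Q : ℝ) (k j : ℕ) : ℝ :=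
  gap Y (k + 1) / (6 * k * magnitude Y Q j * pertConst Y (k + 1))

theorem damping_pos (hQ : 2 * sigma Y 1 ≤ Q) {j k : ℕ} (hj : 1 ≤ j) (hjk : j ≤ k)
    (hgap : 0 < gap Y (k + 1)) : 0 < damping Y Q k j := by
  have h1 := three_mul_gap_le_magnitude hQ hj (hjk.trans k.le_succ)
  have h2 := four_le_pertConst hgap
  have h3 : (0 : ℝ) < k := by exact_mod_cast hj.trans hjk
  have h4 : 0 < magnitude Y Q j := by linarith
  rw [damping]; positivity

theorem twelve_le_cost (hQ : 2 * sigma Y 1 ≤ Q) {j k : ℕ} (hj : 1 ≤ j) (hjk : j ≤ k)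
    (hgap : 0 < gap Y (k + 1)) :
    12 * k ≤ k * pertConst Y (k + 1) * magnitude Y Q j / gap Y (k + 1) := by
  have h1 := three_mul_gap_le_magnitude hQ hj (hjk.trans k.le_succ)
  have h2 := four_le_pertConst hgap
  have h3 : (0 : ℝ) ≤ k := k.cast_nonneg
  rw [le_div_iff₀ hgap]
  calc 12 * k * gap Y (k + 1) = k * 4 * (3 * gap Y (k + 1)) := by ring
    _ ≤ _ := by gcongr

theorem one_div_damping (Y : Matrix (Fin m) (Fin n) ℝ) (Q : ℝ) (k j : ℕ) :
    1 / damping Y Q k j = 6 * (k * pertConst Y (k + 1) * magnitude Y Q j / gap Y (k + 1)) := by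
  rw [damping, one_div_div]; ring

theorem damping_le_one (hQ : 2 * sigma Y 1 ≤ Q) {j k : ℕ} (hj : 1 ≤ j) (hjk : j ≤ k)
    (hgap : 0 < gap Y (k + 1)) : damping Y Q k j ≤ 1 := by
  have h3 : (1 : ℝ) ≤ k := by exact_mod_cast hj.trans hjk
  have h := twelve_le_cost hQ hj hjk hgap
  rw [← one_le_div (damping_pos hQ hj hjk hgap), one_div_damping]
  linarith

theorem bddAbove_Icc {k : ℕ} (f : Set.Icc 1 k → ℝ) : BddAbove (Set.range f) :=
  (Set.finite_range f).bddAbove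

theorem lambert_arg_mem {μ c : ℝ} (h0 : 0 < μ) (h1 : μ < 1) (hc : 0 < c) (hc1 : c ≤ 1) :
    0 < c * (μ * Real.log (1 / μ)) ∧ c * (μ * Real.log (1 / μ)) ≤ Real.exp (-1) := by
  have hl := log_one_div_pos h0 h1
  refine ⟨by positivity, ?_⟩
  calc c * (μ * Real.log (1 / μ)) ≤ 1 * (μ * Real.log (1 / μ)) := by gcongr
    _ ≤ Real.exp (-1) := by rw [one_mul]; exact mul_log_one_div_le_exp h0

/-- The bound on the warm-up rounds, in terms of `Ŵ (c μ log (1 / μ)) / log (1 / μ)` for various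
factors `c`. -/
theorem warmUpBound_eq (hrate : ∀ k ∈ Finset.Icc 1 r, 0 < rate F k ∧ rate F k < 1) (s : ℕ → ℕ)
    {k : ℕ} (hk : 1 ≤ k) (hkr : k < r) :
    warmUpBound Y Q F s k =
      (⨆ j : Set.Icc 1 k, ((s j : ℝ)
        + lambertHat (1 / k * (rate F j * Real.log (1 / rate F j))) / Real.log (1 / rate F j)
        + lambertHat (damping Y Q k j * (rate F j * Real.log (1 / rate F j)))
          / Real.log (1 / rate F j)))
      + (((k : ℝ) + 1) * rate F k / (1 - rate F k) + 2
        + lambertHat (1 * (rate F k * Real.log (1 / rate F k))) / Real.log (1 / rate F k)) := by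
  have hk' := hrate k (Finset.mem_Icc.2 ⟨hk, hkr.le⟩)
  rw [warmUpBound, abs_log_eq hk'.1 hk'.2, one_mul]
  congr 2
  funext j
  have hj := hrate j (Finset.mem_Icc.2 ⟨j.2.1, j.2.2.trans hkr.le⟩)
  rw [abs_log_eq hj.1 hj.2, damping]
  congr 4 <;> ring

theorem le_warmUpBound (hrate : ∀ k ∈ Finset.Icc 1 r, 0 < rate F k ∧ rate F k < 1) (s : ℕ → ℕ)
    {j k : ℕ} (hj : 1 ≤ j) (hjk : j ≤ k) (hkr : k < r) :
    (s j : ℝ)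
      + lambertHat (1 / k * (rate F j * Real.log (1 / rate F j))) / Real.log (1 / rate F j)
      + lambertHat (damping Y Q k j * (rate F j * Real.log (1 / rate F j)))
        / Real.log (1 / rate F j) + 2 ≤ warmUpBound Y Q F s k := by
  have hk' := hrate k (Finset.mem_Icc.2 ⟨hj.trans hjk, hkr.le⟩)
  rw [warmUpBound_eq hrate s (hj.trans hjk) hkr]
  have h1 := le_ciSup (bddAbove_Icc fun j : Set.Icc 1 k => ((s j : ℝ)
        + lambertHat (1 / k * (rate F j * Real.log (1 / rate F j))) / Real.log (1 / rate F j)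
        + lambertHat (damping Y Q k j * (rate F j * Real.log (1 / rate F j)))
          / Real.log (1 / rate F j))) ⟨j, hj, hjk⟩
  have h2 : 0 ≤ ((k : ℝ) + 1) * rate F k / (1 - rate F k) :=
    div_nonneg (mul_nonneg (by positivity) hk'.1.le) (by linarith)
  have h3 : 0 ≤ lambertHat (1 * (rate F k * Real.log (1 / rate F k)))
      / Real.log (1 / rate F k) :=
    div_nonneg (zero_le_one.trans (le_max_left _ _)) (log_one_div_pos hk'.1 hk'.2).le
  simp only at h1
  linarith

theorem add_two_le_warmUpBound
    (hrate : ∀ k ∈ Finset.Icc 1 r, 0 < rate F k ∧ rate F k < 1) (s : ℕ → ℕ)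
    {j k : ℕ} (hj : 1 ≤ j) (hjk : j ≤ k) (hkr : k < r) :
    (s j : ℝ) + 2 ≤ warmUpBound Y Q F s k := by
  have h := le_warmUpBound (Y := Y) (Q := Q) hrate s hj hjk hkr
  obtain ⟨h0, h1⟩ := hrate j (Finset.mem_Icc.2 ⟨hj, hjk.trans hkr.le⟩)
  have hl := (log_one_div_pos h0 h1).le
  have hw : ∀ y, 0 ≤ lambertHat y / Real.log (1 / rate F j) := fun y =>
    div_nonneg (zero_le_one.trans (le_max_left _ _)) hl
  linarith [hw (1 / k * (rate F j * Real.log (1 / rate F j))),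
    hw (damping Y Q k j * (rate F j * Real.log (1 / rate F j)))]

/-- In particular worker `k ≥ 2` is active in round `s k - 1`, so that its error is bounded there
whatever its initial value. -/
theorem two_mul_le_of_isWarmUp
    (hrate : ∀ k ∈ Finset.Icc 1 r, 0 < rate F k ∧ rate F k < 1) {s : ℕ → ℕ}
    (hs : IsWarmUp Y Q F r s) {k : ℕ} (hk : 1 ≤ k) (hkr : k ≤ r) : 2 * k ≤ s k + 1 := by
  induction k, hk using Nat.le_induction with
  | base => rw [hs.1]
  | succ k hk ih =>
    have h := (add_two_le_warmUpBound hrate s hk le_rfl hkr).trans (hs.2 k hk hkr)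
    have h' : s k + 2 ≤ s (k + 1) := by exact_mod_cast h
    have := ih (by omega)
    omega

end WarmUp

/-! ### Convergence after the warm-up rounds -/

section Convergence

variable {m d n r T : ℕ} {Q : ℝ} {W : Matrix (Fin m) (Fin d) ℝ} {X : Matrix (Fin d) (Fin n) ℝ}
  {Y : Matrix (Fin m) (Fin n) ℝ} {rank1 : Subroutine m d n}
  {a : ℕ → ℕ → Fin d → ℝ} {b : ℕ → ℕ → Fin m → ℝ}
  {aBar : ℕ → ℕ → Fin d → ℝ} {bBar : ℕ → ℕ → Fin m → ℝ}
  {aStar : ℕ → Fin d → ℝ} {bStar : ℕ → Fin m → ℝ} {F : ℕ → ℝ}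

/-- If the earlier components converge at their rates after their warm-up rounds, then from round
`s (k + 1)` on the forcing of component `k + 1` decays at the rate `rate F (k + 1)`. -/
theorem forcing_le (hQ : 2 * sigma Y 1 ≤ Q) (hgap : ∀ k ∈ Finset.Icc 1 r, 0 < gap Y k)
    (hF : ∀ k ∈ Finset.Icc 1 r, 0 < F k ∧ F k < 1) {s : ℕ → ℕ} (hs : IsWarmUp Y Q F r s)
    {k : ℕ} (hk : 1 ≤ k) (hkr : k < r) {G : ℕ → ℕ → ℝ}
    (hG : ∀ j, 1 ≤ j → j ≤ k → ∀ ℓ : ℕ, s j ≤ ℓ + 1 →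
      G j ℓ ≤ 3 * magnitude Y Q j * ((ℓ : ℝ) - (s j : ℝ) + 2) * rate F j ^ (ℓ + 1 - s j))
    {ℓ q : ℕ} (hℓ : ℓ + 1 = s (k + 1) + q) :
    2 * pertConst Y (k + 1) * ∑ j ∈ Finset.Ico 1 (k + 1), G j ℓ
      ≤ 3 * gap Y (k + 1) * rate F (k + 1) ^ (q + 1) := by
  have hrate := rate_mem_Ioo hF
  have hk0 : (1 : ℝ) ≤ k := by exact_mod_cast hk
  have hg : 0 < gap Y (k + 1) := hgap _ (Finset.mem_Icc.2 ⟨by omega, hkr⟩)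
  have hC : 0 < pertConst Y (k + 1) := by linarith [four_le_pertConst hg]
  have hterm : ∀ j ∈ Finset.Ico 1 (k + 1), 2 * pertConst Y (k + 1) * G j ℓ
      ≤ 3 * gap Y (k + 1) / k * rate F (k + 1) ^ (q + 1) := by
    intro j hj
    obtain ⟨hj1, hjk⟩ := Finset.mem_Ico.1 hj
    have hjk : j ≤ k := by omega
    obtain ⟨h0, h1⟩ := hrate j (Finset.mem_Icc.2 ⟨hj1, hjk.trans hkr.le⟩)
    have hR : 0 < magnitude Y Q j := by
      linarith [three_mul_gap_le_magnitude hQ hj1 (hjk.trans k.le_succ)]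
    have hw := (le_warmUpBound hrate s hj1 hjk hkr).trans (hs.2 k hk hkr)
    have hsj : s j ≤ s (k + 1) := by
      have := (add_two_le_warmUpBound hrate s hj1 hjk hkr).trans (hs.2 k hk hkr)
      have : s j + 2 ≤ s (k + 1) := by exact_mod_cast this
      omega
    have hN : ((ℓ + 1 - s j : ℕ) : ℝ) = s (k + 1) + q - s j := by
      rw [Nat.cast_sub (by omega), hℓ]; push_cast; ring
    have hℓ' : (ℓ : ℝ) + 1 = s (k + 1) + q := by exact_mod_cast hℓ
    have hM : (1 + k * rate F j) / (k + 1) ≤ rate F (k + 1) := by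
      refine le_trans ?_ (average_le_rate_succ F hk)
      gcongr
      exact rate_le_rate hF hj1 hjk hkr.le
    have y1 := lambert_arg_mem (c := 1 / (k : ℝ)) h0 h1 (by positivity)
      (by rw [div_le_one (by linarith)]; exact hk0)
    have y2 := lambert_arg_mem h0 h1 (damping_pos hQ hj1 hjk hg) (damping_le_one hQ hj1 hjk hg)
    have w1 := lambertHat_spec y1.1 y1.2
    have w2 := lambertHat_spec y2.1 y2.2
    have key := mul_pow_le_of_delay h0 h1 hk hM (damping_pos hQ hj1 hjk hg).le w1.1 w2.1
      (w1.2.trans (by ring)) w2.2 (N := ℓ + 1 - s j) (q := q + 1)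
      (by rw [hN]; push_cast; linarith)
    calc 2 * pertConst Y (k + 1) * G j ℓ
        ≤ 2 * pertConst Y (k + 1) * (3 * magnitude Y Q j * ((ℓ : ℝ) - (s j : ℝ) + 2)
            * rate F j ^ (ℓ + 1 - s j)) := by
          gcongr
          exact hG j hj1 hjk ℓ (by omega)
      _ = 6 * pertConst Y (k + 1) * magnitude Y Q j
            * ((((ℓ + 1 - s j : ℕ) : ℝ) + 1) * rate F j ^ (ℓ + 1 - s j)) := by
          rw [hN, ← hℓ']; ring
      _ ≤ 6 * pertConst Y (k + 1) * magnitude Y Q j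
            * (3 * damping Y Q k j * rate F (k + 1) ^ (q + 1)) := by gcongr
      _ = 3 * gap Y (k + 1) / k * rate F (k + 1) ^ (q + 1) := by
          rw [damping]; field_simp
  rw [Finset.mul_sum]
  refine (Finset.sum_le_card_nsmul _ _ _ hterm).trans (le_of_eq ?_)
  rw [Nat.card_Ico, nsmul_eq_mul, Nat.add_sub_cancel]
  field_simp

/-- Induction on the component: the first one has no forcing, and the forcing of each later one is
controlled by `forcing_le`. -/
theorem totalError_le_of_isWarmUp (hY : Y = W * X) (hgap : ∀ k ∈ Finset.Icc 1 r, 0 < gap Y k)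
    (hQ : 2 * sigma Y 1 ≤ Q) (hrun : IsRun rank1 X Y r T Q a b)
    (hinit : ‖fit X (a 1 0) (b 1 0)‖ ≤ Q)
    (hbar : ∀ k ∈ Finset.Icc 1 r, ∀ ℓ : ℕ, k ≤ ℓ →
      IsBestFit X (target X Y a b k ℓ) (aBar k ℓ) (bBar k ℓ))
    (hstar : ∀ k ∈ Finset.Icc 1 r,
      IsBestFit X (cleanTarget X Y aStar bStar k) (aStar k) (bStar k))
    (hF : Contracts rank1 X Y r T a b aBar bBar F)
    {s : ℕ → ℕ} (hs : IsWarmUp Y Q F r s) {k : ℕ} (hk : k ∈ Finset.Icc 1 r) :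
    ∀ ℓ : ℕ, s k ≤ ℓ + 1 →
      totalError X a b aStar bStar k ℓ ≤
        3 * magnitude Y Q k * ((ℓ : ℝ) - (s k : ℝ) + 2) * rate F k ^ (ℓ + 1 - s k) := by
  have hF' : ∀ k ∈ Finset.Icc 1 r, 0 < F k ∧ F k < 1 := fun k hk => (hF k hk).1
  have hrate := rate_mem_Ioo hF'
  have hσ1 := sigma_nonneg Y 1
  induction k using Nat.strong_induction_on with
  | _ k ih =>
    obtain ⟨hk1, hkr⟩ := Finset.mem_Icc.1 hk
    have hg := hgap k hk
    have hR : 3 * gap Y k ≤ magnitude Y Q k := three_mul_gap_le_magnitude hQ hk1 le_rfl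
    have hsk := two_mul_le_of_isWarmUp hrate hs hk1 hkr
    have hforce : ∀ q : ℕ,
        2 * pertConst Y k * ∑ j ∈ Finset.Ico 1 k, totalError X a b aStar bStar j (s k - 1 + q)
          ≤ 3 * gap Y k * rate F k ^ (q + 1) := by
      intro q
      obtain rfl | ⟨i, hi, rfl⟩ : k = 1 ∨ ∃ i, 1 ≤ i ∧ k = i + 1 := by
        rcases hk1.eq_or_lt with h | h
        · exact Or.inl h.symm
        · exact Or.inr ⟨k - 1, by omega, by omega⟩
      · have := (hrate 1 hk).1
        simp only [Finset.Ico_self, Finset.sum_empty, mul_zero]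
        positivity
      · exact forcing_le hQ hgap hF' hs hi hkr
          (fun j hj hji => ih j (by omega) (Finset.mem_Icc.2 ⟨hj, by omega⟩)) (by omega)
    intro ℓ hℓ
    obtain ⟨q, hq⟩ : ∃ q, ℓ = s k - 1 + q := ⟨ℓ - (s k - 1), by omega⟩
    -- The recursion starts in round `s k - 1`, which for `k = 1` is the initial value.
    have hstep := le_mul_pow_of_forced (G := totalError X a b aStar bStar k) (p := s k - 1)
      (le_rate F hk1) (hrate k hk).1.le (fun _ => norm_nonneg _) (R := magnitude Y Q k)
      (by linarith)
      (totalError_le_magnitude hY hgap (by linarith) hrun hinit hstar hk (by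
        rcases hk1.eq_or_lt with h | h
        · subst h; exact Or.inr ⟨rfl, by rw [hs.1]⟩
        · exact Or.inl (by omega)))
      (fun q => by
        refine (totalError_le hY hgap (by linarith) hrun hbar hstar hF hk
          (ℓ := s k - 1 + q + 1) (by omega)).trans ?_
        rw [Nat.add_sub_cancel]
        have := (hrate k hk).1
        have hR' : 3 * gap Y k * rate F k ^ (q + 1) ≤ 3 * magnitude Y Q k * rate F k ^ (q + 1) := by
          gcongr
          linarith
        linarith [hforce q]) q
    have e1 : ℓ + 1 - s k = q := by omega
    have e2 : (ℓ : ℝ) - s k + 2 = q + 1 := by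
      have : ℓ + 1 = s k + q := by omega
      have : (ℓ : ℝ) + 1 = s k + q := by exact_mod_cast this
      linarith
    rw [e1, e2, hq]
    exact hstep

end Convergence

/-! ### Size of the warm-up rounds -/

section Size

variable {m n r : ℕ} {Q : ℝ} {Y : Matrix (Fin m) (Fin n) ℝ} {F : ℕ → ℝ}

/-- The least admissible warm-up rounds: every lower bound is rounded up to the next integer. -/
noncomputable def leastWarmUp (Y : Matrix (Fin m) (Fin n) ℝ) (Q : ℝ) (F : ℕ → ℝ) : ℕ → ℕ
  | 0 => 0
  | 1 => 1
  | k + 2 => ⌈warmUpBound Y Q F (fun j => if _h : j < k + 2 then leastWarmUp Y Q F j else 0)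
      (k + 1)⌉₊

theorem warmUpBound_congr {s s' : ℕ → ℕ} {k : ℕ} (h : ∀ j ≤ k, s j = s' j) :
    warmUpBound Y Q F s k = warmUpBound Y Q F s' k := by
  rw [warmUpBound, warmUpBound]
  congr 2
  funext j
  rw [h j j.2.2]

theorem leastWarmUp_succ {k : ℕ} (hk : 1 ≤ k) :
    leastWarmUp Y Q F (k + 1) = ⌈warmUpBound Y Q F (leastWarmUp Y Q F) k⌉₊ := by
  obtain ⟨k, rfl⟩ : ∃ i, k = i + 1 := ⟨k - 1, by omega⟩
  rw [leastWarmUp]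
  congr 1
  refine warmUpBound_congr fun j hj => ?_
  rw [dif_pos (by omega)]

theorem isWarmUp_leastWarmUp : IsWarmUp Y Q F r (leastWarmUp Y Q F) := by
  refine ⟨by rw [leastWarmUp], fun k hk _ => ?_⟩
  rw [leastWarmUp_succ hk]
  exact Nat.le_ceil _

/-- Each Lambert term of the warm-up bound is `O(x (1 + log x))`. -/
theorem lambertHat_div_log_le {μ M c H : ℝ} (h0 : 0 < μ) (hμM : μ ≤ M) (hM : M < 1)
    (hc : 0 < c) (hc1 : c ≤ 1) (hH : 1 ≤ H) (hcH : Real.log (1 / c) ≤ 2 * H) :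
    lambertHat (c * (μ * Real.log (1 / μ))) / Real.log (1 / μ)
      ≤ 6 * (H / (1 - M) * (1 + Real.log (H / (1 - M)))) := by
  have h1 : μ < 1 := hμM.trans_lt hM
  have hy := lambert_arg_mem h0 h1 hc hc1
  have hW := lambertHat_le hy.1 hy.2
  set l := Real.log (1 / μ) with hl
  have hl0 : 0 < l := log_one_div_pos h0 h1
  have hM' : 0 < 1 - M := by linarith
  have hlM : 1 / l ≤ 1 / (1 - M) :=
    one_div_le_one_div_of_le hM' (le_trans (by linarith) (one_sub_le_log_one_div h0))
  set x := H / (1 - M) with hx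
  have hMx : 1 / (1 - M) ≤ x := by rw [hx]; gcongr
  have hx1 : 1 ≤ x := by
    refine le_trans ?_ hMx
    rw [le_div_iff₀ hM']; linarith
  have hlogx : 0 ≤ Real.log x := Real.log_nonneg hx1
  have hlog : Real.log (1 / (c * (μ * l))) = l + Real.log (1 / l) + Real.log (1 / c) := by
    have hlμ : l = -Real.log μ := by rw [hl, one_div, Real.log_inv]
    rw [one_div, Real.log_inv, Real.log_mul hc.ne' (mul_pos h0 hl0).ne',
      Real.log_mul h0.ne' hl0.ne', one_div l, one_div c, Real.log_inv, Real.log_inv]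
    linarith
  have t1 : Real.log (1 / l) / l ≤ x * Real.log x := by
    calc Real.log (1 / l) / l ≤ Real.log x / l := by
          gcongr; exact hlM.trans hMx
      _ = 1 / l * Real.log x := by ring
      _ ≤ x * Real.log x := by gcongr; exact hlM.trans hMx
  have t2 : Real.log (1 / c) / l ≤ 2 * x := by
    calc Real.log (1 / c) / l ≤ 2 * H / l := by gcongr
      _ = 2 * H * (1 / l) := by ring
      _ ≤ 2 * H * (1 / (1 - M)) := by gcongr
      _ = 2 * x := by rw [hx]; ring
  calc lambertHat (c * (μ * l)) / l ≤ 2 * (l + Real.log (1 / l) + Real.log (1 / c)) / l := by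
        rw [← hlog]; gcongr
    _ = 2 * (1 + Real.log (1 / l) / l + Real.log (1 / c) / l) := by field_simp
    _ ≤ 2 * (1 + x * Real.log x + 2 * x) := by gcongr
    _ ≤ 6 * (x * (1 + Real.log x)) := by nlinarith [mul_nonneg (zero_le_one.trans hx1) hlogx]

/-- Three Lambert terms, the two additional rounds and the rounding give the constant
`3 * 6 + 2 + 1 = 21`. -/
theorem warmUpBound_add_one_le (hQ : 2 * sigma Y 1 ≤ Q)
    (hgap : ∀ k ∈ Finset.Icc 1 r, 0 < gap Y k)
    (hF : ∀ k ∈ Finset.Icc 1 r, 0 < F k ∧ F k < 1) (s : ℕ → ℕ)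
    {k : ℕ} (hk : 1 ≤ k) (hkr : k < r) :
    warmUpBound Y Q F s k + 1 ≤ simplifiedBound Y Q F 21 s k := by
  have hrate := rate_mem_Ioo hF
  have hg : 0 < gap Y (k + 1) := hgap _ (Finset.mem_Icc.2 ⟨by omega, hkr⟩)
  have hk0 : (1 : ℝ) ≤ k := by exact_mod_cast hk
  obtain ⟨hm0, hm1⟩ := hrate k (Finset.mem_Icc.2 ⟨hk, hkr.le⟩)
  rw [warmUpBound_eq hrate s hk hkr, simplifiedBound]
  set w := lambertHat (1 * (rate F k * Real.log (1 / rate F k))) / Real.log (1 / rate F k)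
    with hw
  suffices h : (⨆ j : Set.Icc 1 k, ((s j : ℝ)
        + lambertHat (1 / k * (rate F j * Real.log (1 / rate F j))) / Real.log (1 / rate F j)
        + lambertHat (damping Y Q k j * (rate F j * Real.log (1 / rate F j)))
          / Real.log (1 / rate F j)))
      ≤ (⨆ j : Set.Icc 1 k,
        ((s j : ℝ) + 21 * (logCost Y Q F k j * (1 + Real.log (logCost Y Q F k j))))) - (w + 3) by
    linarith
  have : Nonempty (Set.Icc 1 k) := ⟨⟨1, le_rfl, hk⟩⟩
  refine ciSup_le fun j => ?_
  have hsup := le_ciSup (bddAbove_Icc fun j : Set.Icc 1 k =>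
    ((s j : ℝ) + 21 * (logCost Y Q F k j * (1 + Real.log (logCost Y Q F k j))))) j
  obtain ⟨j, hj1, hjk⟩ := j
  simp only at hsup ⊢
  refine le_sub_right_of_add_le (le_trans ?_ hsup)
  have hj0 := (hrate j (Finset.mem_Icc.2 ⟨hj1, hjk.trans hkr.le⟩)).1
  have hjk' := rate_le_rate hF hj1 hjk hkr.le
  set z := k * pertConst Y (k + 1) * magnitude Y Q j / gap Y (k + 1) with hz
  have hz12 : 12 * k ≤ z := twelve_le_cost hQ hj1 hjk hg
  have hz0 : 0 < z := by linarith
  set H := Real.log z with hH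
  have hH1 : 1 ≤ H := by
    rw [hH, Real.le_log_iff_exp_le hz0]
    linarith [Real.exp_one_lt_d9]
  have hkH : Real.log (1 / (1 / (k : ℝ))) ≤ 2 * H := by
    rw [one_div_one_div]
    have : Real.log k ≤ H := Real.log_le_log (by linarith) (by linarith)
    linarith
  have hdH : Real.log (1 / damping Y Q k j) ≤ 2 * H := by
    rw [one_div_damping, ← hz, Real.log_mul (by norm_num) hz0.ne']
    have : Real.log 6 ≤ H := Real.log_le_log (by norm_num) (by linarith)
    linarith
  have b1 := lambertHat_div_log_le hj0 hjk' hm1 (c := 1 / (k : ℝ)) (by positivity)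
    (by rw [div_le_one (by linarith)]; exact hk0) hH1 hkH
  have b2 := lambertHat_div_log_le hj0 hjk' hm1 (damping_pos hQ hj1 hjk hg)
    (damping_le_one hQ hj1 hjk hg) hH1 hdH
  have b3 := lambertHat_div_log_le hm0 le_rfl hm1 one_pos le_rfl hH1 (by simp; linarith)
  have hlc : logCost Y Q F k j = H / (1 - rate F k) := rfl
  rw [hlc]
  set x := H / (1 - rate F k) with hx
  have hx1 : 1 ≤ x := by
    rw [hx, le_div_iff₀ (by linarith)]; linarith
  have hxl : 1 ≤ x * (1 + Real.log x) := by nlinarith [Real.log_nonneg hx1]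
  linarith

theorem leastWarmUp_le (hQ : 2 * sigma Y 1 ≤ Q) (hgap : ∀ k ∈ Finset.Icc 1 r, 0 < gap Y k)
    (hF : ∀ k ∈ Finset.Icc 1 r, 0 < F k ∧ F k < 1) {k : ℕ} (hk : 1 ≤ k) (hkr : k < r) :
    (leastWarmUp Y Q F (k + 1) : ℝ) ≤ simplifiedBound Y Q F 21 (leastWarmUp Y Q F) k := by
  refine le_trans ?_ (warmUpBound_add_one_le hQ hgap hF _ hk hkr)
  rw [leastWarmUp_succ hk]
  refine (Nat.ceil_lt_add_one ?_).le
  have := add_two_le_warmUpBound (Y := Y) (Q := Q) (rate_mem_Ioo hF) (leastWarmUp Y Q F) hk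
    le_rfl hkr
  exact le_trans (by positivity) this

end Size

end RankOneDeflation

theorem theorem1 :
    ∃ K : ℝ, 0 < K ∧
      ∀ (m d n r T : ℕ) (Q : ℝ)
        (W : Matrix (Fin m) (Fin d) ℝ) (X : Matrix (Fin d) (Fin n) ℝ)
        (Y : Matrix (Fin m) (Fin n) ℝ)
        (rank1 : RankOneDeflation.Subroutine m d n)
        (a : ℕ → ℕ → Fin d → ℝ) (b : ℕ → ℕ → Fin m → ℝ)
        (aBar : ℕ → ℕ → Fin d → ℝ) (bBar : ℕ → ℕ → Fin m → ℝ)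
        (aStar : ℕ → Fin d → ℝ) (bStar : ℕ → Fin m → ℝ)
        (F : ℕ → ℝ),
        -- the noiseless model, the spectral gaps and the projection radius
        Y = W * X →
        RankOneDeflation.SpectralGap Y r →
        2 * RankOneDeflation.sigma Y 1 ≤ Q →
        -- a run of the algorithm, the first component being initialized in the projection ball
        RankOneDeflation.IsRun rank1 X Y r T Q a b →
        ‖RankOneDeflation.fit X (a 1 0) (b 1 0)‖ ≤ Q →
        -- the ideal rank-one fits of the actual targets
        (∀ k ∈ Finset.Icc 1 r, ∀ ℓ : ℕ, k ≤ ℓ →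
          RankOneDeflation.IsBestFit X (RankOneDeflation.target X Y a b k ℓ)
            (aBar k ℓ) (bBar k ℓ)) →
        -- the ideal components, i.e. best rank-one fits of the clean targets
        (∀ k ∈ Finset.Icc 1 r,
          RankOneDeflation.IsBestFit X (RankOneDeflation.cleanTarget X Y aStar bStar k)
            (aStar k) (bStar k)) →
        -- contraction of the warm-started subroutine
        RankOneDeflation.Contracts rank1 X Y r T a b aBar bBar F →
        -- the effective rates lie in the open unit interval
        (∀ k ∈ Finset.Icc 1 r,
          0 < RankOneDeflation.rate F k ∧ RankOneDeflation.rate F k < 1) ∧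
        -- convergence for every admissible choice of the warm-up rounds
        (∀ s : ℕ → ℕ, RankOneDeflation.IsWarmUp Y Q F r s →
          ∀ k ∈ Finset.Icc 1 r, ∀ ℓ : ℕ, s k ≤ ℓ + 1 →
            RankOneDeflation.totalError X a b aStar bStar k ℓ ≤
              3 * RankOneDeflation.magnitude Y Q k * ((ℓ : ℝ) - (s k : ℝ) + 2)
                * RankOneDeflation.rate F k ^ (ℓ + 1 - s k)) ∧
        -- the simplified size of the warm-up rounds is attained by an admissible choice
        (∃ s : ℕ → ℕ, RankOneDeflation.IsWarmUp Y Q F r s ∧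
          ∀ k : ℕ, 1 ≤ k → k < r →
            (s (k + 1) : ℝ) ≤ RankOneDeflation.simplifiedBound Y Q F K s k) := by
  refine ⟨21, by norm_num, ?_⟩
  intro m d n r T Q W X Y rank1 a b aBar bBar aStar bStar F hY hspec hQ hrun hinit hbar hstar hF
  have hF' : ∀ k ∈ Finset.Icc 1 r, 0 < F k ∧ F k < 1 := fun k hk => (hF k hk).1
  exact ⟨RankOneDeflation.rate_mem_Ioo hF',
    fun s hs k hk => RankOneDeflation.totalError_le_of_isWarmUp hY hspec.gap_pos hQ hrun hinit
      hbar hstar hF hs hk,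
    RankOneDeflation.leastWarmUp Y Q F, RankOneDeflation.isWarmUp_leastWarmUp,
    fun k hk hkr => RankOneDeflation.leastWarmUp_le hQ hspec.gap_pos hF' hk hkr⟩
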